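/- Theorem 14. Let $0<\alpha<1$, $T>0$, and let $$y^{(\alpha)}(x)=\frac{1}{\Gamma(1-\alpha)}\int_0^x\frac{y'(\xi)}{(x-\xi)^\alpha}\,d\xi$$ denote the Caputo derivative of order $\alpha$ with lower limit $0$. Suppose that $y\in C^5[0,T]$ satisfies $y(0)=y'(0)=y''(0)=y'''(0)=0$ and solves $$y^{(\alpha)}(x)+y(x)=f(x),\qquad 0\le x\le T.$$ For a positive integer $N$ put $h=T/N$, $x_n=nh$, $y_n=y(x_n)$, $f_n=f(x_n)$, let $w_k^{(\alpha)}=(-1)^k\binom{\alpha}{k}$ be the Grünwald weights, and let $\gamma=1+h^\alpha\left(1-\frac{17\alpha}{24}+\frac{\alpha^2}{8}\right)$. Define the numerical solution by $\widetilde y_0=\widetilde y_1=0$ and, for $2\le n\le N$, $$\widetilde y_n=\gamma^{-1}\Big[h^\alpha\Big(\tfrac{11\alpha}{12}-\tfrac{\alpha^2}{4}\Big)(f_{n-1}-\widetilde y_{n-1})+h^\alpha\Big(\tfrac{\alpha^2}{8}-\tfrac{5\alpha}{24}\Big)(f_{n-2}-\widetilde y_{n-2})+h^\alpha\Big(1-\tfrac{17\alpha}{24}+\tfrac{\alpha^2}{8}\Big)f_n-\sum_{k=1}^n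 w_k^{(\alpha)}\widetilde y_{n-k}\Big].$$ Let $e_n=y_n-\widetilde y_n$, and for $2\le n\le N$ let the truncation error $A_n$ be the difference between $y_n$ and the right-hand side of the recurrence with every $\widetilde y_m$ replaced by $y_m$. Then $\widetilde y$ converges to $y$ on $[0,T]$ with accuracy $O(h^3)$. More precisely, there is a constant $A>0$, independent of $N$ and $n$, such that for every $N\ge1$, with $h=T/N$: (a) $|A_n|<A\,h^{3+\alpha}$ for $2\le n\le N$; (b) $|e_n|<\dfrac{10A}{(1-\alpha)2^\alpha}\,n^\alpha h^{3+\alpha}$ for $1\le n\le N$; (c) $|e_n|<\dfrac{10A\,T^\alpha}{(1-\alpha)2^\alpha}\,h^{3}$ for $0\le n\le N$. -/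

import Mathlib

/-- The Caputo derivative of order `α` (`0 < α < 1`) with lower limit `0`:
`y^(α)(x) = 1/Γ(1-α) ∫₀ˣ y'(ξ) / (x-ξ)^α dξ`. -/
noncomputable def caputoDeriv (α : ℝ) (y : ℝ → ℝ) (x : ℝ) : ℝ :=
  1 / Real.Gamma (1 - α) * ∫ ξ in (0 : ℝ)..x, deriv y ξ / (x - ξ) ^ α

/-- The Grünwald weights `w_n^(α) = (-1)^n * binom(α, n)`. -/
noncomputable def grunwaldWeight (α : ℝ) (n : ℕ) : ℝ :=
  (-1) ^ n * Ring.choose α n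

/-- The number `γ = 1 + h^α (1 - 17α/24 + α²/8)`. -/
noncomputable def schemeGamma (α h : ℝ) : ℝ :=
  1 + h ^ α * (1 - 17 * α / 24 + α ^ 2 / 8)

/-- The right-hand side of the three-point scheme at the node `n` (used for `n ≥ 2`), with step `h`,
source term `f` and nodal values `u`. It involves `u` only at nodes `< n`. -/
noncomputable def schemeRHS (α h : ℝ) (f : ℝ → ℝ) (u : ℕ → ℝ) (n : ℕ) : ℝ :=
  (schemeGamma α h)⁻¹ *
    (h ^ α * (11 * α / 12 - α ^ 2 / 4) * (f (((n - 1 : ℕ) : ℝ) * h) - u (n - 1))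
      + h ^ α * (α ^ 2 / 8 - 5 * α / 24) * (f (((n - 2 : ℕ) : ℝ) * h) - u (n - 2))
      + h ^ α * (1 - 17 * α / 24 + α ^ 2 / 8) * f ((n : ℝ) * h)
      - ∑ k ∈ Finset.Icc 1 n, grunwaldWeight α k * u (n - k))

theorem schemeRHS_congr (α h : ℝ) (f : ℝ → ℝ) {u v : ℕ → ℝ} {n : ℕ} (hn : 2 ≤ n)
    (huv : ∀ m < n, u m = v m) : schemeRHS α h f u n = schemeRHS α h f v n := by
  unfold schemeRHS
  rw [huv (n - 1) (by omega), huv (n - 2) (by omega)]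
  congr 2
  refine Finset.sum_congr rfl fun k hk => ?_
  rw [Finset.mem_Icc] at hk
  rw [huv (n - k) (by omega)]

/-- The numerical solution: zero at the nodes `0` and `1`, and computed by the scheme from the
values at the earlier nodes when `n ≥ 2`. -/
noncomputable def numericalSolution (α h : ℝ) (f : ℝ → ℝ) (n : ℕ) : ℝ :=
  if 2 ≤ n then
    schemeRHS α h f (fun m => if m < n then numericalSolution α h f m else 0) n
  else 0
termination_by n

theorem numericalSolution_zero (α h : ℝ) (f : ℝ → ℝ) : numericalSolution α h f 0 = 0 := by
  rw [numericalSolution]; simp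

theorem numericalSolution_one (α h : ℝ) (f : ℝ → ℝ) : numericalSolution α h f 1 = 0 := by
  rw [numericalSolution]; simp

/-- For `n ≥ 2` the numerical solution satisfies the recurrence relation. -/
theorem numericalSolution_recurrence (α h : ℝ) (f : ℝ → ℝ) {n : ℕ} (hn : 2 ≤ n) :
    numericalSolution α h f n = schemeRHS α h f (numericalSolution α h f) n := by
  rw [numericalSolution, if_pos hn]
  exact schemeRHS_congr α h f hn fun m hm => if_pos hm

/-- The truncation error of the scheme at the node `n ≥ 2` for the function `y`: the residual that is
left when the exact values `y (m h)` are inserted in the recurrence. -/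
noncomputable def truncationError (α h : ℝ) (f y : ℝ → ℝ) (n : ℕ) : ℝ :=
  y ((n : ℝ) * h) - schemeRHS α h f (fun m => y ((m : ℝ) * h)) n

open Filter Topology Asymptotics

/-! Consistency. Since `y` and its first three derivatives vanish at 0, both `y` and its Caputo
derivative are integrals of y'''' against the powers (x-t)^3/6 and (x-t)^(3-α)/Γ(4-α)
(`exists_integral_representation`). Using the equation to replace f - y by the Caputo derivative, γ
A_n becomes h^3 ∫ K((x_n-t)/h) y''''(t) dt with a Peano kernel K free of h. Everything rests on the
decay |K(u)| ≤ C u^(-α) (`exists_abs_peanoKernel_le`): this is integrable, and rescaling turns it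
into h^(3+α) (`exists_truncationError_le`).

The decay is a cancellation. The cubic moments of the Grünwald weights are explicit polynomials
times the partial sum P_n of the weights, and P_n n^α has a three-term expansion in 1/n with error
O(n^(-3)) (`grunwaldSum_mul_rpow_sub_isBigO`). The weights c_0, c_1, c_2 are such that the orders
n^(3-α), n^(2-α) and n^(1-α) of K cancel.

Stability. The error obeys the scheme's linear recurrence with residual γ A_n. For h ≤ 1 the
coefficients of the past errors are nonnegative with sum at most 1 - P_(n-1), and P_(n-1) ≥
(1-α)(n-1)^(-α); this gap absorbs the residual in an induction giving |e_n| ≤ B n^α h^(3+α)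
(`abs_le_mul_rpow_of_recurrence`). The finitely many grids with h > 1 only enlarge the constant. -/

/-! ### Recurrences, signs and a lower bound for the Grünwald weights and their partial sums -/

theorem grunwaldWeight_zero (α : ℝ) : grunwaldWeight α 0 = 1 := by
  simp [grunwaldWeight]

theorem grunwaldWeight_succ (α : ℝ) (n : ℕ) :
    ((n : ℝ) + 1) * grunwaldWeight α (n + 1) = (n - α) * grunwaldWeight α n := by
  unfold grunwaldWeight
  rw [Ring.choose_eq_smul, Ring.choose_eq_smul, descPochhammer_succ_right,
    Polynomial.smeval_mul, Polynomial.smeval_sub, Polynomial.smeval_X, Polynomial.smeval_natCast,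
    Nat.factorial_succ]
  have := Nat.factorial_ne_zero n
  simp only [smul_eq_mul, pow_one, pow_zero, nsmul_eq_mul, mul_one]
  push_cast
  field_simp
  ring

/-- The partial sums `∑_{k ≤ n} w_k^(α)` of the Grünwald weights. -/
noncomputable def grunwaldSum (α : ℝ) (n : ℕ) : ℝ :=
  ∑ k ∈ Finset.range (n + 1), grunwaldWeight α k

theorem grunwaldSum_zero (α : ℝ) : grunwaldSum α 0 = 1 := by
  simp [grunwaldSum, grunwaldWeight_zero]

theorem grunwaldSum_succ_eq_add (α : ℝ) (n : ℕ) :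
    grunwaldSum α (n + 1) = grunwaldSum α n + grunwaldWeight α (n + 1) := by
  rw [grunwaldSum, Finset.sum_range_succ, grunwaldSum]

/-- Source of both the product formula for the partial sums and the sign of the weights. -/
theorem grunwaldWeight_succ_eq_sum (α : ℝ) (n : ℕ) :
    ((n : ℝ) + 1) * grunwaldWeight α (n + 1) = -α * grunwaldSum α n := by
  induction n with
  | zero => rw [grunwaldWeight_succ, grunwaldSum_zero, grunwaldWeight_zero]; simp
  | succ n ih =>
    rw [grunwaldWeight_succ, grunwaldSum_succ_eq_add]
    push_cast
    linear_combination ih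

theorem grunwaldSum_succ (α : ℝ) (n : ℕ) :
    grunwaldSum α (n + 1) = (n + 1 - α) / (n + 1) * grunwaldSum α n := by
  have h : ((n : ℝ) + 1) ≠ 0 := by positivity
  rw [grunwaldSum_succ_eq_add]
  field_simp
  linear_combination grunwaldWeight_succ_eq_sum α n

theorem grunwaldSum_pos {α : ℝ} (hα1 : α < 1) (n : ℕ) : 0 < grunwaldSum α n := by
  induction n with
  | zero => rw [grunwaldSum_zero]; norm_num
  | succ n ih =>
    rw [grunwaldSum_succ]
    have : (0 : ℝ) ≤ n := n.cast_nonneg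
    have : 0 < (n : ℝ) + 1 - α := by linarith
    positivity

theorem grunwaldWeight_succ_nonpos {α : ℝ} (hα0 : 0 < α) (hα1 : α < 1) (n : ℕ) :
    grunwaldWeight α (n + 1) ≤ 0 := by
  have h := grunwaldWeight_succ_eq_sum α n
  have h1 := mul_pos hα0 (grunwaldSum_pos hα1 n)
  have h2 : (0 : ℝ) ≤ n := n.cast_nonneg
  by_contra! h3
  nlinarith [mul_pos (by linarith : (0 : ℝ) < n + 1) h3]

/-- Bernoulli's inequality (1 - 1/(n+2))^α ≤ 1 - α/(n+2) compares the successive ratios of the two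
sides; they agree at n = 0. -/
theorem one_sub_mul_rpow_le_grunwaldSum {α : ℝ} (hα0 : 0 < α) (hα1 : α < 1) (n : ℕ) :
    (1 - α) * ((n : ℝ) + 1) ^ (-α) ≤ grunwaldSum α (n + 1) := by
  induction n with
  | zero => simp [grunwaldSum_succ, grunwaldSum_zero]
  | succ n ih =>
    rw [grunwaldSum_succ]
    have hn : (0 : ℝ) ≤ n := n.cast_nonneg
    have hb := rpow_one_add_le_one_add_mul_self (s := -(1 / ((n : ℝ) + 2)))
      (by rw [neg_le_neg_iff, div_le_one (by positivity)]; linarith) hα0.le hα1.le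
    have h1 : (1 : ℝ) + -(1 / ((n : ℝ) + 2)) = (n + 1) / (n + 2) := by field_simp; ring
    have h2 : (1 : ℝ) + α * -(1 / ((n : ℝ) + 2)) = (((n + 1 : ℕ) : ℝ) + 1 - α) / (((n + 1 : ℕ) : ℝ) + 1) := by
      push_cast; field_simp; ring
    have h3 : (((n : ℝ) + 1) / (n + 2)) ^ α * ((n : ℝ) + 1) ^ (-α) = (((n + 1 : ℕ) : ℝ) + 1) ^ (-α) := by
      rw [Real.div_rpow (by positivity) (by positivity), Real.rpow_neg (by positivity),
        Real.rpow_neg (by positivity)]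
      have : ((n : ℝ) + 1) ^ α ≠ 0 := by positivity
      have e : ((n + 1 : ℕ) : ℝ) + 1 = n + 2 := by push_cast; ring
      rw [e]
      field_simp
    rw [h1, h2] at hb
    calc (1 - α) * (((n + 1 : ℕ) : ℝ) + 1) ^ (-α)
        = (((n : ℝ) + 1) / (n + 2)) ^ α * ((1 - α) * ((n : ℝ) + 1) ^ (-α)) := by rw [← h3]; ring
      _ ≤ _ := mul_le_mul hb ih (mul_nonneg (by linarith) (by positivity))
        ((by positivity : (0 : ℝ) ≤ (((n : ℝ) + 1) / (n + 2)) ^ α).trans hb)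

/-! ### Moments of the Grünwald weights -/

/-- Raising n by one expands (n+1-k)^j binomially, so each moment grows by lower moments, ending
with the partial sum itself. The same induction serves j = 1, 2, 3. -/
theorem sum_grunwaldWeight_mul_sub (α : ℝ) (n : ℕ) :
    (1 - α) * ∑ k ∈ Finset.range (n + 1), grunwaldWeight α k * ((n : ℝ) - k)
      = n * grunwaldSum α n := by
  induction n with
  | zero => simp
  | succ n ih =>
    have h : ∑ k ∈ Finset.range (n + 1 + 1), grunwaldWeight α k * (((n + 1 : ℕ) : ℝ) - k)
        = ∑ k ∈ Finset.range (n + 1), grunwaldWeight α k * ((n : ℝ) - k) + grunwaldSum α n := by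
      rw [Finset.sum_range_succ, grunwaldSum, ← Finset.sum_add_distrib]
      simp only [sub_self, mul_zero, add_zero]
      refine Finset.sum_congr rfl fun k _ => ?_
      push_cast; ring
    have hn : (n : ℝ) + 1 ≠ 0 := by positivity
    rw [h, mul_add, ih, grunwaldSum_succ]
    push_cast
    field_simp
    ring

theorem sum_grunwaldWeight_mul_sub_sq (α : ℝ) (n : ℕ) :
    (1 - α) * (2 - α) * ∑ k ∈ Finset.range (n + 1), grunwaldWeight α k * ((n : ℝ) - k) ^ 2
      = n * (2 * n - α) * grunwaldSum α n := by
  induction n with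
  | zero => simp
  | succ n ih =>
    have h : ∑ k ∈ Finset.range (n + 1 + 1), grunwaldWeight α k * (((n + 1 : ℕ) : ℝ) - k) ^ 2
        = ∑ k ∈ Finset.range (n + 1), grunwaldWeight α k * ((n : ℝ) - k) ^ 2
          + 2 * ∑ k ∈ Finset.range (n + 1), grunwaldWeight α k * ((n : ℝ) - k)
          + grunwaldSum α n := by
      rw [Finset.sum_range_succ, grunwaldSum, Finset.mul_sum, ← Finset.sum_add_distrib,
        ← Finset.sum_add_distrib]
      simp only [sub_self, ne_eq, OfNat.ofNat_ne_zero, not_false_eq_true, zero_pow, mul_zero,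
        add_zero]
      refine Finset.sum_congr rfl fun k _ => ?_
      push_cast; ring
    have hn : (n : ℝ) + 1 ≠ 0 := by positivity
    have h1 := sum_grunwaldWeight_mul_sub α n
    rw [h, mul_add, mul_add, ih, show (1 - α) * (2 - α) * (2 * ∑ k ∈ Finset.range (n + 1),
      grunwaldWeight α k * ((n : ℝ) - k)) = 2 * (2 - α) * ((1 - α) * ∑ k ∈ Finset.range (n + 1),
      grunwaldWeight α k * ((n : ℝ) - k)) by ring, h1, grunwaldSum_succ]
    push_cast
    field_simp
    ring

theorem sum_grunwaldWeight_mul_sub_cube (α : ℝ) (n : ℕ) :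
    (1 - α) * (2 - α) * (3 - α) *
        ∑ k ∈ Finset.range (n + 1), grunwaldWeight α k * ((n : ℝ) - k) ^ 3
      = n * (6 * n ^ 2 - 6 * α * n + α + α ^ 2) * grunwaldSum α n := by
  induction n with
  | zero => simp
  | succ n ih =>
    have h : ∑ k ∈ Finset.range (n + 1 + 1), grunwaldWeight α k * (((n + 1 : ℕ) : ℝ) - k) ^ 3
        = ∑ k ∈ Finset.range (n + 1), grunwaldWeight α k * ((n : ℝ) - k) ^ 3
          + 3 * ∑ k ∈ Finset.range (n + 1), grunwaldWeight α k * ((n : ℝ) - k) ^ 2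
          + 3 * ∑ k ∈ Finset.range (n + 1), grunwaldWeight α k * ((n : ℝ) - k)
          + grunwaldSum α n := by
      rw [Finset.sum_range_succ, grunwaldSum, Finset.mul_sum, Finset.mul_sum,
        ← Finset.sum_add_distrib, ← Finset.sum_add_distrib, ← Finset.sum_add_distrib]
      simp only [sub_self, ne_eq, OfNat.ofNat_ne_zero, not_false_eq_true, zero_pow, mul_zero,
        add_zero]
      refine Finset.sum_congr rfl fun k _ => ?_
      push_cast; ring
    have hn : (n : ℝ) + 1 ≠ 0 := by positivity
    have h1 := sum_grunwaldWeight_mul_sub α n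
    have h2 := sum_grunwaldWeight_mul_sub_sq α n
    rw [h, grunwaldSum_succ]
    have key : ((n + 1 : ℕ) : ℝ) * (6 * ((n + 1 : ℕ) : ℝ) ^ 2 - 6 * α * ((n + 1 : ℕ) : ℝ) + α + α ^ 2)
        * ((n + 1 - α) / (n + 1) * grunwaldSum α n) =
        (6 * ((n : ℝ) + 1) ^ 2 - 6 * α * ((n : ℝ) + 1) + α + α ^ 2) * (n + 1 - α)
          * grunwaldSum α n := by
      push_cast
      field_simp
    rw [key]
    linear_combination ih + 3 * (3 - α) * h2 + 3 * (2 - α) * (3 - α) * h1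

/-- The shift θ lets the kernel be evaluated between integers. -/
theorem sum_grunwaldWeight_mul_add_sub_cube (α : ℝ) (n : ℕ) (θ : ℝ) :
    (1 - α) * (2 - α) * (3 - α) *
        ∑ k ∈ Finset.range (n + 1), grunwaldWeight α k * ((n : ℝ) + θ - k) ^ 3
      = (n * (6 * n ^ 2 - 6 * α * n + α + α ^ 2) + 3 * θ * (3 - α) * (n * (2 * n - α))
          + 3 * θ ^ 2 * (2 - α) * (3 - α) * n + θ ^ 3 * ((1 - α) * (2 - α) * (3 - α)))
        * grunwaldSum α n := by
  have h : ∑ k ∈ Finset.range (n + 1), grunwaldWeight α k * ((n : ℝ) + θ - k) ^ 3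
      = ∑ k ∈ Finset.range (n + 1), grunwaldWeight α k * ((n : ℝ) - k) ^ 3
        + 3 * θ * ∑ k ∈ Finset.range (n + 1), grunwaldWeight α k * ((n : ℝ) - k) ^ 2
        + 3 * θ ^ 2 * ∑ k ∈ Finset.range (n + 1), grunwaldWeight α k * ((n : ℝ) - k)
        + θ ^ 3 * grunwaldSum α n := by
    rw [grunwaldSum, Finset.mul_sum, Finset.mul_sum, Finset.mul_sum,
      ← Finset.sum_add_distrib, ← Finset.sum_add_distrib, ← Finset.sum_add_distrib]
    refine Finset.sum_congr rfl fun k _ => ?_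
    ring
  rw [h]
  linear_combination sum_grunwaldWeight_mul_sub_cube α n
    + 3 * θ * (3 - α) * sum_grunwaldWeight_mul_sub_sq α n
    + 3 * θ ^ 2 * (2 - α) * (3 - α) * sum_grunwaldWeight_mul_sub α n

/-! ### Asymptotics of the partial sums -/

/-- Up to elementary factors the partial sum is the product in the denominator of Euler's sequence
for Γ(1-α). -/
theorem tendsto_grunwaldSum_mul_rpow {α : ℝ} (hα1 : α < 1) :
    Tendsto (fun n : ℕ => grunwaldSum α n * (n : ℝ) ^ α) atTop (𝓝 (1 / Real.Gamma (1 - α))) := by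
  have hprod : ∀ n : ℕ, ∏ j ∈ Finset.range (n + 1), ((1 - α) + (j : ℝ))
      = grunwaldSum α n * (n.factorial : ℝ) * (n + 1 - α) := by
    intro n
    induction n with
    | zero => simp [grunwaldSum_zero]
    | succ n ih =>
      have hn : (n : ℝ) + 1 ≠ 0 := by positivity
      rw [Finset.prod_range_succ, ih, grunwaldSum_succ, Nat.factorial_succ]
      push_cast
      field_simp
      ring
  have hG := Real.GammaSeq_tendsto_Gamma (1 - α)
  have hpos : 0 < Real.Gamma (1 - α) := Real.Gamma_pos_of_pos (by linarith)
  have hlim : Tendsto (fun n : ℕ => (1 : ℝ) + (1 - α) / (n : ℝ)) atTop (𝓝 1) := by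
    simpa using tendsto_const_nhds.add (tendsto_const_div_atTop_nhds_zero_nat (1 - α))
  have := (hlim.mul hG).inv₀ (by simpa using hpos.ne')
  rw [one_mul, ← one_div] at this
  refine this.congr' ?_
  filter_upwards [eventually_gt_atTop 0] with n hn
  have hn' : (0 : ℝ) < n := by exact_mod_cast hn
  have h1 : (n : ℝ) + 1 - α ≠ 0 := by linarith
  have h2 := (grunwaldSum_pos hα1 n).ne'
  have h3 : (n : ℝ) ^ (1 - α) * n ^ α = n := by
    rw [← Real.rpow_add hn']; simp
  have h4 : (n : ℝ) ^ α ≠ 0 := (Real.rpow_pos_of_pos hn' _).ne'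
  have h5 : (n : ℝ) ^ (1 - α) ≠ 0 := (Real.rpow_pos_of_pos hn' _).ne'
  have hf : (n.factorial : ℝ) ≠ 0 := by positivity
  rw [Real.GammaSeq, hprod, inv_eq_iff_eq_inv]
  rw [show (1 : ℝ) + (1 - α) / n = (n + 1 - α) / ((n : ℝ) ^ (1 - α) * n ^ α) by
    rw [h3]; field_simp; ring]
  field_simp

/-- Telescoping: n^(-4) is dominated by differences of n^(-3), so u - 8c n^(-3) eventually increases
and u + 8c n^(-3) eventually decreases, both to L. -/
theorem isBigO_sub_of_isBigO_sub_succ {u : ℕ → ℝ} {L : ℝ} (hu : Tendsto u atTop (𝓝 L))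
    (h : (fun n => u (n + 1) - u n) =O[atTop] fun n : ℕ => ((n : ℝ)⁻¹) ^ 4) :
    (fun n => u n - L) =O[atTop] fun n : ℕ => ((n : ℝ)⁻¹) ^ 3 := by
  obtain ⟨c, hc0, hc⟩ := h.exists_pos
  obtain ⟨n₀, hn₀⟩ := eventually_atTop.1 (hc.bound.and (eventually_gt_atTop 0))
  have hinv : Tendsto (fun n : ℕ => 8 * c * ((n : ℝ)⁻¹) ^ 3) atTop (𝓝 0) := by
    simpa using (tendsto_inv_atTop_nhds_zero_nat (𝕜 := ℝ)).pow 3 |>.const_mul (8 * c)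
  have hstep : ∀ n ≥ n₀, |u (n + 1) - u n|
      ≤ 8 * c * ((n : ℝ)⁻¹) ^ 3 - 8 * c * (((n + 1 : ℕ) : ℝ)⁻¹) ^ 3 := by
    intro n hn
    obtain ⟨h1, h2⟩ := hn₀ n hn
    have h2' : (1 : ℝ) ≤ n := by exact_mod_cast h2
    rw [Real.norm_eq_abs, Real.norm_eq_abs, abs_of_nonneg (by positivity : (0:ℝ) ≤ ((n : ℝ)⁻¹) ^ 4)] at h1
    refine h1.trans ?_
    -- The factor 8 is generous: after clearing denominators (n+1)^3 ≤ 8 n^3 suffices.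
    have : ((n : ℝ)⁻¹) ^ 4 ≤ 8 * (((n : ℝ)⁻¹) ^ 3 - (((n + 1 : ℕ) : ℝ)⁻¹) ^ 3) := by
      push_cast
      rw [← sub_nonneg]
      have e : 8 * (((n : ℝ)⁻¹) ^ 3 - (((n : ℝ) + 1)⁻¹) ^ 3) - ((n : ℝ)⁻¹) ^ 4
          = (8 * n * (3 * n ^ 2 + 3 * n + 1) - (n + 1) ^ 3) / (n ^ 4 * ((n : ℝ) + 1) ^ 3) := by
        have : (n : ℝ) ≠ 0 := by positivity
        field_simp
        ring
      rw [e]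
      apply div_nonneg _ (by positivity)
      nlinarith [sq_nonneg (n : ℝ), mul_nonneg (sub_nonneg.2 h2') (sq_nonneg (n : ℝ))]
    nlinarith
  refine IsBigO.of_bound (8 * c) (eventually_atTop.2 ⟨n₀, fun n hn => ?_⟩)
  rw [Real.norm_eq_abs, Real.norm_eq_abs, abs_of_nonneg (by positivity : (0:ℝ) ≤ ((n : ℝ)⁻¹) ^ 3),
    abs_le]
  have hupper : ∀ m ≥ n, u m - 8 * c * ((m : ℝ)⁻¹) ^ 3 ≥ u n - 8 * c * ((n : ℝ)⁻¹) ^ 3 := by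
    intro m hm
    induction m, hm using Nat.le_induction with
    | base => exact le_rfl
    | succ m hm ih =>
      have := (abs_le.1 (hstep m (hn.trans hm))).1
      linarith
  have hlower : ∀ m ≥ n, u m + 8 * c * ((m : ℝ)⁻¹) ^ 3 ≤ u n + 8 * c * ((n : ℝ)⁻¹) ^ 3 := by
    intro m hm
    induction m, hm using Nat.le_induction with
    | base => exact le_rfl
    | succ m hm ih =>
      have := (abs_le.1 (hstep m (hn.trans hm))).2
      linarith
  have l1 := ge_of_tendsto (by simpa using hu.sub hinv) (eventually_atTop.2 ⟨n, hupper⟩)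
  have l2 := le_of_tendsto (by simpa using hu.add hinv) (eventually_atTop.2 ⟨n, hlower⟩)
  constructor <;> linarith

theorem one_add_rpow_sub_cubic_isBigO (p : ℝ) :
    (fun x : ℝ => (1 + x) ^ p - (1 + p * x + p * (p - 1) / 2 * x ^ 2
      + p * (p - 1) * (p - 2) / 6 * x ^ 3)) =O[𝓝 0] fun x => x ^ 4 := by
  have h := (Real.one_add_rpow_hasFPowerSeriesAt_zero (a := p)).isBigO_sub_partialSum_pow 4
  have h' := h.trans (IsBigO.of_bound 1 (g := fun x : ℝ => x ^ 4)
    (Eventually.of_forall fun x => by simp))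
  refine h'.congr_left fun x => ?_
  have hc : ∀ n, (binomialSeries ℝ p).coeff n = Ring.choose p n := fun n => by
    simp [binomialSeries]
  have h2 : (2 : Polynomial ℤ).smeval p = 2 := by
    have := Polynomial.smeval_natCast (R := ℤ) p 2
    push_cast at this
    simpa using this
  simp [FormalMultilinearSeries.partialSum, Finset.sum_range_succ, hc, h2,
    Ring.choose_eq_smul, descPochhammer_succ_right, Polynomial.smeval_mul, Polynomial.smeval_sub,
    Polynomial.smeval_X, Nat.factorial]
  ring

theorem one_add_rpow_sub_quadratic_isBigO (p : ℝ) :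
    (fun x : ℝ => (1 + x) ^ p - (1 + p * x + p * (p - 1) / 2 * x ^ 2)) =O[𝓝 0] fun x => x ^ 3 := by
  have h := (one_add_rpow_sub_cubic_isBigO p).trans
    (IsBigO.of_bound 1 (g := fun x : ℝ => x ^ 3) ?_)
  · have h2 : (fun x : ℝ => p * (p - 1) * (p - 2) / 6 * x ^ 3) =O[𝓝 0] fun x => x ^ 3 :=
      (isBigO_refl _ _).const_mul_left _
    exact (h.add h2).congr_left fun x => by ring
  · filter_upwards [Metric.ball_mem_nhds (0 : ℝ) one_pos] with x hx
    rw [Metric.mem_ball, dist_zero_right] at hx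
    rw [norm_pow, norm_pow, one_mul]
    exact pow_le_pow_of_le_one (norm_nonneg _) hx.le (by norm_num)

/-- The first three terms of the expansion in `x = 1/n` of the Grünwald partial sums, up to the
factor `n^(-α) / Γ(1-α)`. -/
noncomputable def grunwaldExpansion (α x : ℝ) : ℝ :=
  1 - α * (1 - α) / 2 * x + α * (α + 1) * (1 - α) * (2 - 3 * α) / 24 * x ^ 2

theorem tendsto_grunwaldExpansion (α : ℝ) :
    Tendsto (fun n : ℕ => grunwaldExpansion α (n : ℝ)⁻¹) atTop (𝓝 1) := by
  have h : Continuous (grunwaldExpansion α) := by unfold grunwaldExpansion; fun_prop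
  have h0 : grunwaldExpansion α 0 = 1 := by simp [grunwaldExpansion]
  have := (h.tendsto 0).comp (tendsto_inv_atTop_nhds_zero_nat (𝕜 := ℝ))
  rwa [h0] at this

/-- With x = 1/n and x/(1+x) = 1/(n+1), this says that the expansion satisfies the recurrence of P_n
n^α up to O(x^4), which determines its coefficients. -/
theorem grunwaldExpansion_step_isBigO (α : ℝ) :
    (fun x : ℝ => (1 + x) * (1 + x - α * x) * grunwaldExpansion α x
        - (1 + x) ^ (-α) * ((1 + x) ^ 2 * grunwaldExpansion α (x / (1 + x)))) =O[𝓝 0]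
      fun x => x ^ 4 := by
  have h := one_add_rpow_sub_cubic_isBigO (-α)
  set a₁ : ℝ := -(α * (1 - α) / 2) with ha₁
  set a₂ : ℝ := α * (α + 1) * (1 - α) * (2 - 3 * α) / 24 with ha₂
  let D : ℝ → ℝ := fun x => (1 + x) ^ 2 + a₁ * x * (1 + x) + a₂ * x ^ 2
  have hD : D =O[𝓝 0] fun _ => (1 : ℝ) := by
    exact Tendsto.isBigO_one ℝ (Continuous.tendsto (by fun_prop) 0)
  have h1 := (h.mul hD)
  simp only [mul_one] at h1
  let b₂ : ℝ := -α * (-α - 1) / 2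
  let b₃ : ℝ := -α * (-α - 1) * (-α - 2) / 6
  let d₁ : ℝ := 2 + a₁
  let d₂ : ℝ := 1 + a₁ + a₂
  -- What is left of the polynomial part: orders 0 to 3 cancel by the choice of `a₁` and `a₂`.
  have h2 : (fun x : ℝ => x ^ 4 * ((1 - α) * a₂ - (b₂ * d₂ + b₃ * d₁) - b₃ * d₂ * x)) =O[𝓝 0]
      fun x => x ^ 4 := by
    have : (fun x : ℝ => (1 - α) * a₂ - (b₂ * d₂ + b₃ * d₁) - b₃ * d₂ * x) =O[𝓝 0]
        fun _ => (1 : ℝ) :=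
      Tendsto.isBigO_one ℝ (Continuous.tendsto (by fun_prop) 0)
    simpa using (isBigO_refl (fun x : ℝ => x ^ 4) _).mul this
  refine (h2.sub h1).congr' ?_ EventuallyEq.rfl
  filter_upwards [Metric.ball_mem_nhds (0 : ℝ) one_pos] with x hx
  rw [Metric.mem_ball, dist_zero_right, Real.norm_eq_abs, abs_lt] at hx
  have hx0 : 1 + x ≠ 0 := by linarith
  have e : (1 + x) ^ 2 * grunwaldExpansion α (x / (1 + x)) = D x := by
    simp only [D, grunwaldExpansion, ha₁, ha₂]
    field_simp
    ring
  rw [e]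
  simp only [D, b₂, b₃, d₁, d₂, ha₁, ha₂, grunwaldExpansion]
  ring

/-- The quotient of P_n n^α by its expansion has increments O(n^(-4)), hence approaches its limit at
rate O(n^(-3)). -/
theorem grunwaldSum_mul_rpow_sub_isBigO {α : ℝ} (hα1 : α < 1) :
    (fun n : ℕ => grunwaldSum α n * (n : ℝ) ^ α
        - 1 / Real.Gamma (1 - α) * grunwaldExpansion α (n : ℝ)⁻¹) =O[atTop]
      fun n : ℕ => ((n : ℝ)⁻¹) ^ 3 := by
  set u : ℕ → ℝ := fun n => grunwaldSum α n * (n : ℝ) ^ α / grunwaldExpansion α (n : ℝ)⁻¹ with hu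
  have hφ := tendsto_grunwaldExpansion α
  have hφ0 : ∀ᶠ n : ℕ in atTop, grunwaldExpansion α (n : ℝ)⁻¹ ≠ 0 :=
    hφ.eventually_ne one_ne_zero
  have hP := tendsto_grunwaldSum_mul_rpow hα1
  have hulim : Tendsto u atTop (𝓝 (1 / Real.Gamma (1 - α))) := by
    have := hP.div hφ one_ne_zero
    rwa [div_one] at this
  have hinv := tendsto_inv_atTop_nhds_zero_nat (𝕜 := ℝ)
  have hstep : (fun n => u (n + 1) - u n) =O[atTop] fun n : ℕ => ((n : ℝ)⁻¹) ^ 4 := by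
    have hB := (grunwaldExpansion_step_isBigO α).comp_tendsto hinv
    have hfac : Tendsto (fun n : ℕ => grunwaldSum α n * (n : ℝ) ^ α * (1 + (n : ℝ)⁻¹) ^ α
        / ((1 + (n : ℝ)⁻¹) ^ 2 * grunwaldExpansion α (n : ℝ)⁻¹
          * grunwaldExpansion α ((n + 1 : ℕ) : ℝ)⁻¹)) atTop
        (𝓝 (1 / Real.Gamma (1 - α) * (1 + 0) ^ α / ((1 + 0) ^ 2 * 1 * 1))) := by
      have h1 : Tendsto (fun n : ℕ => (1 : ℝ) + (n : ℝ)⁻¹) atTop (𝓝 (1 + 0)) :=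
        tendsto_const_nhds.add hinv
      refine (hP.mul (h1.rpow_const (Or.inl (by norm_num)))).div
        (((h1.pow 2).mul hφ).mul ((tendsto_add_atTop_iff_nat 1).2 hφ)) (by norm_num)
    have := (hfac.isBigO_one ℝ).mul hB
    simp only [one_mul, Function.comp_def] at this
    refine this.congr' ?_ EventuallyEq.rfl
    filter_upwards [hφ0, (tendsto_add_atTop_nat 1).eventually hφ0, eventually_gt_atTop 0]
      with n h1 h2 h3
    have hn : (0 : ℝ) < n := by exact_mod_cast h3
    have e1 : (n : ℝ)⁻¹ / (1 + (n : ℝ)⁻¹) = ((n + 1 : ℕ) : ℝ)⁻¹ := by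
      push_cast; field_simp
    have e2 : ((n + 1 : ℕ) : ℝ) ^ α = (n : ℝ) ^ α * (1 + (n : ℝ)⁻¹) ^ α := by
      rw [← Real.mul_rpow hn.le (by positivity)]
      congr 1; push_cast; field_simp
    have e3 : (1 + (n : ℝ)⁻¹) ^ (-α) = ((1 + (n : ℝ)⁻¹) ^ α)⁻¹ := Real.rpow_neg (by positivity) _
    have e4 : grunwaldSum α (n + 1)
        = (1 + (n : ℝ)⁻¹ - α * (n : ℝ)⁻¹) / (1 + (n : ℝ)⁻¹) * grunwaldSum α n := by
      rw [grunwaldSum_succ]; field_simp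
    have e5 : (1 + (n : ℝ)⁻¹) ^ α ≠ 0 := by positivity
    have e6 : 1 + (n : ℝ)⁻¹ ≠ 0 := by positivity
    simp only [hu]
    rw [e1, e2, e3, e4]
    generalize grunwaldExpansion α ((n + 1 : ℕ) : ℝ)⁻¹ = φ' at *
    generalize grunwaldExpansion α (n : ℝ)⁻¹ = φ at *
    generalize (1 + (n : ℝ)⁻¹) ^ α = z at *
    generalize 1 + (n : ℝ)⁻¹ = w at *
    generalize (n : ℝ)⁻¹ = x at *
    field_simp
  have h := (isBigO_sub_of_isBigO_sub_succ hulim hstep).mul (hφ.isBigO_one ℝ)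
  simp only [mul_one] at h
  refine h.congr' ?_ EventuallyEq.rfl
  filter_upwards [hφ0] with n hn
  simp only [hu]
  generalize grunwaldExpansion α (n : ℝ)⁻¹ = φ at *
  field_simp

/-! ### Decay of the Peano kernel -/

/-- The weights `c₀, c₁, c₂` of the Caputo derivatives at the nodes `n, n - 1, n - 2`. -/
noncomputable def caputoWeight (α : ℝ) (j : ℕ) : ℝ :=
  match j with
  | 0 => 1 - 17 * α / 24 + α ^ 2 / 8
  | 1 => 11 * α / 12 - α ^ 2 / 4
  | 2 => α ^ 2 / 8 - 5 * α / 24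
  | _ => 0

/-- The Peano kernel of the three-point approximation on the grid of step one, for `n + 1` nodes. -/
noncomputable def peanoKernel (α : ℝ) (n : ℕ) (u : ℝ) : ℝ :=
  ∑ k ∈ Finset.range (n + 1), grunwaldWeight α k * ((max (u - k) 0) ^ 3 / 6)
    - ∑ j ∈ Finset.range 3, caputoWeight α j * ((max (u - j) 0) ^ (3 - α) / Real.Gamma (4 - α))

theorem Gamma_four_sub {α : ℝ} (hα1 : α < 1) :
    Real.Gamma (4 - α) = (1 - α) * (2 - α) * (3 - α) * Real.Gamma (1 - α) := by
  rw [show 4 - α = (3 - α) + 1 by ring, Real.Gamma_add_one (by linarith),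
    show 3 - α = (2 - α) + 1 by ring, Real.Gamma_add_one (by linarith),
    show 2 - α = (1 - α) + 1 by ring, Real.Gamma_add_one (by linarith)]
  ring

/-- At u = n + θ no truncated power needs its maximum, so both sums expand in 1/n. A common factor
n^(3-α) times a remainder O(n^(-3)), uniform in θ, gives n^(-α). -/
theorem exists_abs_peanoKernel_asymptotic {α : ℝ} (hα0 : 0 < α) (hα1 : α < 1) :
    ∃ C : ℝ, ∃ n₀ : ℕ, 2 ≤ n₀ ∧ ∀ n : ℕ, n₀ ≤ n → ∀ θ ∈ Set.Icc (0 : ℝ) 1,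
      |∑ k ∈ Finset.range (n + 1), grunwaldWeight α k * (((n : ℝ) + θ - k) ^ 3 / 6)
        - ∑ j ∈ Finset.range 3, caputoWeight α j *
          (((n : ℝ) + θ - j) ^ (3 - α) / Real.Gamma (4 - α))| ≤ C * (n : ℝ) ^ (-α) := by
  obtain ⟨C₁, hC₁0, hC₁⟩ := (grunwaldSum_mul_rpow_sub_isBigO hα1).exists_pos
  obtain ⟨C₂, hC₂0, hC₂⟩ := (one_add_rpow_sub_quadratic_isBigO (3 - α)).exists_pos
  obtain ⟨δ, hδ0, hδ⟩ := Metric.eventually_nhds_iff.1 hC₂.bound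
  obtain ⟨n₁, hn₁⟩ := eventually_atTop.1 hC₁.bound
  obtain ⟨n₂, hn₂⟩ := exists_nat_gt (2 / δ)
  set Γ₁ := Real.Gamma (1 - α) with hΓ₁
  have hΓ₁0 : 0 < Γ₁ := Real.Gamma_pos_of_pos (by linarith)
  set K : ℝ := (1 - α) * (2 - α) * (3 - α) with hK
  have hK0 : 0 < K := mul_pos (mul_pos (by linarith) (by linarith)) (by linarith)
  have hΓ₄ : Real.Gamma (4 - α) = K * Γ₁ := Gamma_four_sub hα1
  set a₁ : ℝ := -(α * (1 - α) / 2) with ha₁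
  set a₂ : ℝ := α * (α + 1) * (1 - α) * (2 - 3 * α) / 24 with ha₂
  let g₁ : ℝ → ℝ := fun θ => -α + θ * (3 - α)
  let g₂ : ℝ → ℝ := fun θ => (α + α ^ 2) / 6 - α * θ * (3 - α) / 2 + θ ^ 2 * (2 - α) * (3 - α) / 2
  let g₃ : ℝ → ℝ := fun θ => θ ^ 3 * K / 6
  -- n^3 G(1/n, θ) is one sixth of the polynomial in the cubic moment. `S` collects the orders 3 to
  -- 5 of the expansion times `G`; compactness bounds both uniformly in θ.
  let G : ℝ × ℝ → ℝ := fun z => 1 + g₁ z.2 * z.1 + g₂ z.2 * z.1 ^ 2 + g₃ z.2 * z.1 ^ 3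
  let S : ℝ × ℝ → ℝ := fun z => (g₃ z.2 + a₁ * g₂ z.2 + a₂ * g₁ z.2)
    + z.1 * (a₁ * g₃ z.2 + a₂ * g₂ z.2) + z.1 ^ 2 * (a₂ * g₃ z.2)
  have hcpt : IsCompact (Set.Icc (0 : ℝ) 1 ×ˢ Set.Icc (0 : ℝ) 1) := isCompact_Icc.prod isCompact_Icc
  obtain ⟨B₁, hB₁⟩ := hcpt.exists_bound_of_continuousOn (f := G) (by fun_prop)
  obtain ⟨B₂, hB₂⟩ := hcpt.exists_bound_of_continuousOn (f := S) (by fun_prop)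
  let W : ℝ := ∑ j ∈ Finset.range 3, |caputoWeight α j| * (C₂ * 8)
  refine ⟨(B₂ + Γ₁ * C₁ * B₁ + W) / (K * Γ₁), max (max n₁ n₂) 2, le_max_right _ _,
    fun n hn θ hθ => ?_⟩
  have hn1 : n₁ ≤ n := (le_max_left _ _).trans ((le_max_left _ _).trans hn)
  have hn2 : n₂ ≤ n := (le_max_right _ _).trans ((le_max_left _ _).trans hn)
  have hn3 : (2 : ℝ) ≤ n := by exact_mod_cast (le_max_right _ _).trans hn
  have hn0 : (0 : ℝ) < n := by linarith
  set x : ℝ := (n : ℝ)⁻¹ with hx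
  have hx0 : 0 < x := by positivity
  have hxn : x * n = 1 := inv_mul_cancel₀ hn0.ne'
  have hx1 : x ≤ 1 := inv_le_one_of_one_le₀ (by linarith)
  have hxδ : 2 * x < δ := by
    have : 2 / δ < n := hn₂.trans_le (by exact_mod_cast hn2)
    rw [div_lt_iff₀ hδ0] at this
    nlinarith
  have hz : ((x, θ) : ℝ × ℝ) ∈ Set.Icc (0 : ℝ) 1 ×ˢ Set.Icc (0 : ℝ) 1 := ⟨⟨hx0.le, hx1⟩, hθ⟩
  have hG := hB₁ _ hz
  have hS := hB₂ _ hz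
  rw [Real.norm_eq_abs] at hG hS
  have hP := hn₁ n hn1
  set ε : ℝ := grunwaldSum α n * (n : ℝ) ^ α - 1 / Γ₁ * grunwaldExpansion α x with hε
  rw [Real.norm_eq_abs, Real.norm_eq_abs, abs_of_nonneg (by positivity : 0 ≤ x ^ 3)] at hP
  let η : ℕ → ℝ := fun j => (1 + (θ - j) * x) ^ (3 - α)
    - (1 + (3 - α) * ((θ - j) * x) + (3 - α) * (3 - α - 1) / 2 * ((θ - j) * x) ^ 2)
  -- Here |θ - j| ≤ 2, whence 8 = 2^3.
  have hη : ∀ j ∈ Finset.range 3, |η j| ≤ C₂ * 8 * x ^ 3 := by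
    intro j hj
    have hj' : (j : ℝ) ≤ 2 := by exact_mod_cast Nat.le_of_lt_succ (Finset.mem_range.1 hj)
    have hj0 : (0 : ℝ) ≤ j := j.cast_nonneg
    have hv : |(θ - j) * x| ≤ 2 * x := by
      rw [abs_mul, abs_of_pos hx0]
      refine mul_le_mul_of_nonneg_right (abs_le.2 ⟨?_, ?_⟩) hx0.le <;> linarith [hθ.1, hθ.2]
    have := hδ (y := (θ - j) * x) (by rw [dist_zero_right]; exact hv.trans_lt hxδ)
    refine this.trans ?_
    rw [norm_pow, Real.norm_eq_abs, mul_assoc]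
    refine mul_le_mul_of_nonneg_left ((pow_le_pow_left₀ (abs_nonneg _) hv 3).trans (le_of_eq ?_))
      hC₂0.le
    ring
  have hna : (n : ℝ) ^ (-α) * (n : ℝ) ^ α = 1 := by
    rw [← Real.rpow_add hn0]; simp
  have hn3a : (n : ℝ) ^ (3 - α) = (n : ℝ) ^ 3 * (n : ℝ) ^ (-α) := by
    rw [sub_eq_add_neg, Real.rpow_add hn0]; norm_cast
  have hsum : K * ∑ k ∈ Finset.range (n + 1), grunwaldWeight α k * (((n : ℝ) + θ - k) ^ 3 / 6)
      = (n : ℝ) ^ 3 * (n : ℝ) ^ (-α) * (G (x, θ) * (1 / Γ₁ * grunwaldExpansion α x + ε)) := by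
    have h := sum_grunwaldWeight_mul_add_sub_cube α n θ
    rw [← hK] at h
    have e : ∑ k ∈ Finset.range (n + 1), grunwaldWeight α k * (((n : ℝ) + θ - k) ^ 3 / 6)
        = (∑ k ∈ Finset.range (n + 1), grunwaldWeight α k * ((n : ℝ) + θ - k) ^ 3) / 6 := by
      rw [Finset.sum_div]
      exact Finset.sum_congr rfl fun k _ => by ring
    rw [e, mul_div_assoc', h, hε, add_sub_cancel]
    rw [show (n : ℝ) ^ 3 * (n : ℝ) ^ (-α) * (G (x, θ) * (grunwaldSum α n * (n : ℝ) ^ α))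
      = ((n : ℝ) ^ (-α) * (n : ℝ) ^ α) * ((n : ℝ) ^ 3 * G (x, θ)) * grunwaldSum α n by ring, hna]
    have : (n : ℝ) ^ 3 * G (x, θ) = (n : ℝ) ^ 3 + g₁ θ * n ^ 2 + g₂ θ * n + g₃ θ := by
      simp only [G, hx]
      field_simp
    rw [this]
    simp only [g₁, g₂, g₃, hK]
    ring
  have hpow : ∀ j ∈ Finset.range 3, ((n : ℝ) + θ - j) ^ (3 - α)
      = (n : ℝ) ^ 3 * (n : ℝ) ^ (-α) * (1 + (θ - j) * x) ^ (3 - α) := by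
    intro j hj
    have hj' : (j : ℝ) ≤ 2 := by exact_mod_cast Nat.le_of_lt_succ (Finset.mem_range.1 hj)
    have e : (n : ℝ) + θ - j = n * (1 + (θ - j) * x) := by
      rw [hx]; field_simp; ring
    have h1 : 0 ≤ 1 + (θ - j) * x := by
      have : 0 ≤ (n : ℝ) * (1 + (θ - j) * x) := by rw [← e]; linarith [hθ.1]
      exact nonneg_of_mul_nonneg_right this hn0
    rw [e, Real.mul_rpow hn0.le h1, hn3a]
  have hexp : grunwaldExpansion α x = 1 + a₁ * x + a₂ * x ^ 2 := by
    rw [grunwaldExpansion, ha₁, ha₂]; ring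
  have hmain : K * Γ₁ * (∑ k ∈ Finset.range (n + 1),
        grunwaldWeight α k * (((n : ℝ) + θ - k) ^ 3 / 6)
        - ∑ j ∈ Finset.range 3, caputoWeight α j *
          (((n : ℝ) + θ - j) ^ (3 - α) / Real.Gamma (4 - α)))
      = (n : ℝ) ^ 3 * (n : ℝ) ^ (-α) * (x ^ 3 * S (x, θ) + Γ₁ * ε * G (x, θ)
          - ∑ j ∈ Finset.range 3, caputoWeight α j * η j) := by
    have e2 : K * Γ₁ * ∑ j ∈ Finset.range 3, caputoWeight α j *
          (((n : ℝ) + θ - j) ^ (3 - α) / Real.Gamma (4 - α))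
        = (n : ℝ) ^ 3 * (n : ℝ) ^ (-α) * ∑ j ∈ Finset.range 3, caputoWeight α j *
          (1 + (θ - j) * x) ^ (3 - α) := by
      rw [Finset.mul_sum, Finset.mul_sum]
      refine Finset.sum_congr rfl fun j hj => ?_
      rw [hpow j hj, hΓ₄]
      field_simp
    have e3 : ∑ j ∈ Finset.range 3, caputoWeight α j * (1 + (θ - j) * x) ^ (3 - α)
        = (1 + a₁ * x + a₂ * x ^ 2) * G (x, θ) - x ^ 3 * S (x, θ)
          + ∑ j ∈ Finset.range 3, caputoWeight α j * η j := by
      -- The identity behind the choice of the c_j: orders 0, 1 and 2 in x agree for every θ.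
      have h1 : ∑ j ∈ Finset.range 3, caputoWeight α j * (1 + (3 - α) * ((θ - j) * x)
          + (3 - α) * (3 - α - 1) / 2 * ((θ - j) * x) ^ 2)
          = (1 + a₁ * x + a₂ * x ^ 2) * G (x, θ) - x ^ 3 * S (x, θ) := by
        simp only [Finset.sum_range_succ, Finset.sum_range_zero, caputoWeight, G, S, g₁, g₂, g₃,
          ha₁, ha₂]
        push_cast
        ring
      rw [← h1, ← Finset.sum_add_distrib]
      exact Finset.sum_congr rfl fun j _ => by simp only [η]; ring
    rw [mul_sub, e2, e3, mul_right_comm, hsum, hexp]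
    field_simp
    ring
  have hbound : |x ^ 3 * S (x, θ) + Γ₁ * ε * G (x, θ)
      - ∑ j ∈ Finset.range 3, caputoWeight α j * η j| ≤ x ^ 3 * (B₂ + Γ₁ * C₁ * B₁ + W) := by
    have b1 : |x ^ 3 * S (x, θ)| ≤ x ^ 3 * B₂ := by
      rw [abs_mul, abs_of_pos (by positivity : 0 < x ^ 3)]
      exact mul_le_mul_of_nonneg_left hS (by positivity)
    have b2 : |Γ₁ * ε * G (x, θ)| ≤ Γ₁ * (C₁ * x ^ 3) * B₁ := by
      rw [abs_mul, abs_mul, abs_of_pos hΓ₁0]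
      exact mul_le_mul (mul_le_mul_of_nonneg_left hP hΓ₁0.le) hG (abs_nonneg _) (by positivity)
    have b3 : |∑ j ∈ Finset.range 3, caputoWeight α j * η j| ≤ W * x ^ 3 := by
      refine (Finset.abs_sum_le_sum_abs _ _).trans ?_
      rw [Finset.sum_mul]
      refine Finset.sum_le_sum fun j hj => ?_
      rw [abs_mul, mul_assoc]
      exact mul_le_mul_of_nonneg_left (hη j hj) (abs_nonneg _)
    have := abs_sub (x ^ 3 * S (x, θ) + Γ₁ * ε * G (x, θ))
      (∑ j ∈ Finset.range 3, caputoWeight α j * η j)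
    have := abs_add_le (x ^ 3 * S (x, θ)) (Γ₁ * ε * G (x, θ))
    linarith
  have hKΓ : 0 < K * Γ₁ := mul_pos hK0 hΓ₁0
  rw [div_mul_eq_mul_div, le_div_iff₀' hKΓ]
  nth_rewrite 1 [← abs_of_pos hKΓ]
  rw [← abs_mul, hmain, abs_mul, abs_of_pos (by positivity : 0 < (n : ℝ) ^ 3 * (n : ℝ) ^ (-α))]
  refine (mul_le_mul_of_nonneg_left hbound (by positivity)).trans (le_of_eq ?_)
  have : (n : ℝ) ^ 3 * x ^ 3 = 1 := by rw [← mul_pow, mul_comm, hxn, one_pow]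
  linear_combination (n : ℝ) ^ (-α) * (B₂ + Γ₁ * C₁ * B₁ + W) * this

/-- Below n₀ the kernel is bounded independently of N, since terms with k > n₀ vanish, and u^(-α) ≥
n₀^(-α). Above n₀ the asymptotic bound applies with n = ⌊u⌋; u ≤ N ensures that every nonzero term
is present. -/
theorem exists_abs_peanoKernel_le {α : ℝ} (hα0 : 0 < α) (hα1 : α < 1) :
    ∃ C : ℝ, 0 ≤ C ∧ ∀ N : ℕ, ∀ u : ℝ, 0 < u → u ≤ N → |peanoKernel α N u| ≤ C * u ^ (-α) := by
  obtain ⟨C, n₀, hn₀, hC⟩ := exists_abs_peanoKernel_asymptotic hα0 hα1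
  have hΓ : 0 < Real.Gamma (4 - α) := Real.Gamma_pos_of_pos (by linarith)
  have hn₀0 : (0 : ℝ) < n₀ := by exact_mod_cast (by omega : 0 < n₀)
  let D : ℝ := ∑ k ∈ Finset.range (n₀ + 1), |grunwaldWeight α k| * ((n₀ : ℝ) ^ 3 / 6)
    + ∑ j ∈ Finset.range 3, |caputoWeight α j| * ((n₀ : ℝ) ^ (3 - α) / Real.Gamma (4 - α))
  have hD : 0 ≤ D := by positivity
  refine ⟨D * (n₀ : ℝ) ^ α + 2 ^ α * |C|, by positivity, fun N u hu huN => ?_⟩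
  have hua : 0 < u ^ (-α) := Real.rpow_pos_of_pos hu _
  rcases lt_or_ge u n₀ with h | h
  · have hsplit : ∑ k ∈ Finset.range (N + 1), |grunwaldWeight α k * ((max (u - k) 0) ^ 3 / 6)|
        ≤ ∑ k ∈ Finset.range (n₀ + 1), |grunwaldWeight α k| * ((n₀ : ℝ) ^ 3 / 6) := by
      have hz : ∀ k : ℕ, n₀ + 1 ≤ k →
          |grunwaldWeight α k * ((max (u - k) 0) ^ 3 / 6)| = 0 := by
        intro k hk
        have : (n₀ : ℝ) + 1 ≤ k := by exact_mod_cast hk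
        rw [max_eq_right (by linarith)]; simp
      have h1 : ∑ k ∈ Finset.range (N + 1), |grunwaldWeight α k * ((max (u - k) 0) ^ 3 / 6)|
          ≤ ∑ k ∈ Finset.range (n₀ + 1), |grunwaldWeight α k * ((max (u - k) 0) ^ 3 / 6)| := by
        rw [← Finset.sum_filter_add_sum_filter_not (Finset.range (N + 1)) (· < n₀ + 1),
          Finset.sum_eq_zero (s := Finset.filter (fun k => ¬ k < n₀ + 1) _)
            fun k hk => hz k (not_lt.1 (Finset.mem_filter.1 hk).2), add_zero]
        exact Finset.sum_le_sum_of_subset_of_nonneg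
          (fun k hk => Finset.mem_range.2 (Finset.mem_filter.1 hk).2) fun _ _ _ => abs_nonneg _
      refine h1.trans (Finset.sum_le_sum fun k _ => ?_)
      have hk0 : (0 : ℝ) ≤ k := k.cast_nonneg
      rw [abs_mul, abs_of_nonneg (by positivity : 0 ≤ (max (u - k) 0) ^ 3 / 6)]
      have : max (u - k) 0 ≤ n₀ := max_le (by linarith) hn₀0.le
      gcongr
    have hsplit2 : ∑ j ∈ Finset.range 3,
          |caputoWeight α j * ((max (u - j) 0) ^ (3 - α) / Real.Gamma (4 - α))|
        ≤ ∑ j ∈ Finset.range 3, |caputoWeight α j| * ((n₀ : ℝ) ^ (3 - α) / Real.Gamma (4 - α)) := by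
      refine Finset.sum_le_sum fun k _ => ?_
      have hk0 : (0 : ℝ) ≤ k := k.cast_nonneg
      rw [abs_mul, abs_of_nonneg (by positivity :
        0 ≤ (max (u - k) 0) ^ (3 - α) / Real.Gamma (4 - α))]
      have h1 : max (u - k) 0 ≤ n₀ := max_le (by linarith) hn₀0.le
      have h2 : (0 : ℝ) ≤ 3 - α := by linarith
      gcongr
    have hK : |peanoKernel α N u| ≤ D := by
      refine (abs_sub _ _).trans (add_le_add ?_ ?_)
      · exact (Finset.abs_sum_le_sum_abs _ _).trans hsplit
      · exact (Finset.abs_sum_le_sum_abs _ _).trans hsplit2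
    have h1 : 1 ≤ (n₀ : ℝ) ^ α * u ^ (-α) := by
      rw [Real.rpow_neg hu.le, ← div_eq_mul_inv, ← Real.div_rpow hn₀0.le hu.le]
      exact Real.one_le_rpow ((one_le_div hu).2 h.le) hα0.le
    have : D ≤ D * ((n₀ : ℝ) ^ α * u ^ (-α)) := le_mul_of_one_le_right hD h1
    have h3 : 0 ≤ 2 ^ α * |C| * u ^ (-α) := by positivity
    nlinarith
  · set n := ⌊u⌋₊ with hn
    have hnu : (n : ℝ) ≤ u := Nat.floor_le hu.le
    have hun : u < n + 1 := Nat.lt_floor_add_one u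
    have hn0 : n₀ ≤ n := Nat.le_floor h
    have hn1 : (2 : ℝ) ≤ n := by exact_mod_cast hn₀.trans hn0
    have hnN : n ≤ N := by
      have : (n : ℝ) ≤ N := hnu.trans huN
      exact_mod_cast this
    have hb := hC n hn0 (u - n) ⟨by linarith, by linarith⟩
    have e : peanoKernel α N u = ∑ k ∈ Finset.range (n + 1),
          grunwaldWeight α k * (((n : ℝ) + (u - n) - k) ^ 3 / 6)
        - ∑ j ∈ Finset.range 3, caputoWeight α j *
          (((n : ℝ) + (u - n) - j) ^ (3 - α) / Real.Gamma (4 - α)) := by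
      rw [peanoKernel, add_sub_cancel]
      congr 1
      · rw [← Finset.sum_subset (Finset.range_mono (by omega : n + 1 ≤ N + 1))]
        · refine Finset.sum_congr rfl fun k hk => ?_
          have : (k : ℝ) ≤ n := by exact_mod_cast Nat.le_of_lt_succ (Finset.mem_range.1 hk)
          rw [max_eq_left (by linarith)]
        · intro k _ hk
          have : (n : ℝ) + 1 ≤ k := by exact_mod_cast not_lt.1 (fun h => hk (Finset.mem_range.2 h))
          rw [max_eq_right (by linarith)]; simp
      · refine Finset.sum_congr rfl fun j hj => ?_
        have : (j : ℝ) ≤ 2 := by exact_mod_cast Nat.le_of_lt_succ (Finset.mem_range.1 hj)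
        rw [max_eq_left (by linarith)]
    rw [e]
    refine hb.trans ?_
    -- Since n ≥ 2 and u < n + 1, n ≥ u/2.
    have h1 : (n : ℝ) ^ (-α) ≤ 2 ^ α * u ^ (-α) := by
      rw [show (2 : ℝ) ^ α = (2⁻¹ : ℝ) ^ (-α) by
        rw [Real.inv_rpow (by norm_num), Real.rpow_neg (by norm_num), inv_inv],
        ← Real.mul_rpow (by norm_num) hu.le]
      exact Real.rpow_le_rpow_of_nonpos (by positivity) (by linarith) (by linarith)
    have h2 : 0 ≤ D * (n₀ : ℝ) ^ α * u ^ (-α) := by positivity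
    calc C * (n : ℝ) ^ (-α) ≤ |C| * (n : ℝ) ^ (-α) := by gcongr; exact le_abs_self C
      _ ≤ |C| * (2 ^ α * u ^ (-α)) := by gcongr
      _ ≤ _ := by linarith

/-! ### Integral representations -/

/-- Integration by parts: the boundary term at x vanishes because p + 1 > 0, the one at 0 because
u(0) = 0. Allowing p > -1 covers the singular Caputo kernel. -/
theorem integral_sub_rpow_mul_eq {p x : ℝ} (hp : -1 < p) (hx : 0 ≤ x) {u v : ℝ → ℝ}
    (hu : ContinuousOn u (Set.Icc 0 x)) (hv : ContinuousOn v (Set.Icc 0 x))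
    (huv : ∀ ξ ∈ Set.Ioo 0 x, HasDerivAt u (v ξ) ξ) (hu0 : u 0 = 0) :
    ∫ ξ in (0 : ℝ)..x, (x - ξ) ^ p * u ξ
      = 1 / (p + 1) * ∫ ξ in (0 : ℝ)..x, (x - ξ) ^ (p + 1) * v ξ := by
  have hp1 : 0 < p + 1 := by linarith
  have hcont : Continuous fun ξ : ℝ => (x - ξ) ^ (p + 1) :=
    (continuous_const.sub continuous_id).rpow_const fun _ => Or.inr hp1.le
  have h := intervalIntegral.integral_mul_deriv_eq_deriv_mul_of_hasDerivAt (a := 0) (b := x)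
    (u := u) (u' := v) (v := fun ξ => -(x - ξ) ^ (p + 1) / (p + 1)) (v' := fun ξ => (x - ξ) ^ p)
    (by rwa [Set.uIcc_of_le hx]) (hcont.neg.div_const _).continuousOn
    (by rwa [min_eq_left hx, max_eq_right hx]) ?_
    (ContinuousOn.intervalIntegrable (by rwa [Set.uIcc_of_le hx])) ?_
  · simp only [sub_self, Real.zero_rpow hp1.ne', hu0, neg_zero, zero_div, mul_zero, zero_mul,
      sub_zero, zero_sub] at h
    rw [← intervalIntegral.integral_neg] at h
    rw [← intervalIntegral.integral_const_mul]
    calc _ = ∫ ξ in (0 : ℝ)..x, u ξ * (x - ξ) ^ p := by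
          congr 1; ext ξ; ring
      _ = _ := by
          rw [h]; congr 1; ext ξ; ring
  · intro ξ hξ
    rw [min_eq_left hx, max_eq_right hx] at hξ
    have h1 : HasDerivAt (fun ξ : ℝ => x - ξ) (-1) ξ := by
      simpa using (hasDerivAt_id ξ).const_sub x
    have h2 := ((h1.rpow_const (p := p + 1) (Or.inl (by linarith [hξ.2]))).neg).div_const (p + 1)
    convert! h2 using 1
    rw [add_sub_cancel_right]
    field_simp
  · have := (intervalIntegral.intervalIntegrable_rpow' (a := x) (b := 0) hp).comp_sub_left x
    simpa using this

theorem integral_sub_rpow_mul_eq_iterate {p T x : ℝ} (hp : -1 < p) (hx : x ∈ Set.Icc 0 T)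
    {g : ℕ → ℝ → ℝ} (hc : ∀ i ≤ 4, ContinuousOn (g i) (Set.Icc 0 T))
    (hd : ∀ i ≤ 3, ∀ ξ ∈ Set.Ioo 0 T, HasDerivAt (g i) (g (i + 1) ξ) ξ)
    (h0 : ∀ i ≤ 3, g i 0 = 0) :
    ∫ ξ in (0 : ℝ)..x, (x - ξ) ^ p * g 1 ξ
      = 1 / ((p + 1) * (p + 2) * (p + 3)) * ∫ ξ in (0 : ℝ)..x, (x - ξ) ^ (p + 3) * g 4 ξ := by
  have step : ∀ i ≤ 3, ∀ q : ℝ, -1 < q → ∫ ξ in (0 : ℝ)..x, (x - ξ) ^ q * g i ξ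
      = 1 / (q + 1) * ∫ ξ in (0 : ℝ)..x, (x - ξ) ^ (q + 1) * g (i + 1) ξ := fun i hi q hq =>
    integral_sub_rpow_mul_eq hq hx.1 ((hc i (by omega)).mono (Set.Icc_subset_Icc_right hx.2))
      ((hc (i + 1) (by omega)).mono (Set.Icc_subset_Icc_right hx.2))
      (fun ξ hξ => hd i hi ξ ⟨hξ.1, hξ.2.trans_le hx.2⟩) (h0 i hi)
  rw [step 1 (by norm_num) p hp, step 2 (by norm_num) (p + 1) (by linarith),
    step 3 (by norm_num) (p + 1 + 1) (by linarith), show p + 1 + 1 = p + 2 by ring,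
    show p + 2 + 1 = p + 3 by ring]
  simp only [one_div, mul_inv]
  ring

/-- Three integrations by parts, with exponent p = 0 for `y` and p = -α for its Caputo derivative.
-/
theorem exists_integral_representation {α T : ℝ} (hα1 : α < 1) (hT : 0 < T)
    {y : ℝ → ℝ} (hy : ContDiffOn ℝ 5 y (Set.Icc 0 T))
    (hy0 : ∀ k ≤ 3, iteratedDerivWithin k y (Set.Icc 0 T) 0 = 0) :
    ∃ g : ℝ → ℝ, ContinuousOn g (Set.Icc 0 T) ∧
      (∀ x ∈ Set.Icc 0 T, y x = ∫ t in (0 : ℝ)..x, (x - t) ^ 3 / 6 * g t) ∧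
      ∀ x ∈ Set.Icc 0 T, caputoDeriv α y x
        = ∫ t in (0 : ℝ)..x, (x - t) ^ (3 - α) / Real.Gamma (4 - α) * g t := by
  set g : ℕ → ℝ → ℝ := fun i => iteratedDerivWithin i y (Set.Icc 0 T) with hg
  have hU : UniqueDiffOn ℝ (Set.Icc 0 T) := uniqueDiffOn_Icc hT
  have hc : ∀ i ≤ 4, ContinuousOn (g i) (Set.Icc 0 T) := fun i hi =>
    hy.continuousOn_iteratedDerivWithin (by exact_mod_cast (by omega : i ≤ 5)) hU
  have hd : ∀ i ≤ 3, ∀ ξ ∈ Set.Ioo 0 T, HasDerivAt (g i) (g (i + 1) ξ) ξ := by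
    intro i hi ξ hξ
    have hξ' := Set.Ioo_subset_Icc_self hξ
    have h1 := hy.differentiableOn_iteratedDerivWithin (m := i)
      (by exact_mod_cast (by omega : i < 5)) hU ξ hξ'
    have h2 := h1.hasDerivWithinAt.hasDerivAt (Icc_mem_nhds hξ.1 hξ.2)
    simpa only [hg, iteratedDerivWithin_succ] using h2
  have hg0 : g 0 = y := by simp [hg]
  refine ⟨g 4, hc 4 le_rfl, fun x hx => ?_, fun x hx => ?_⟩
  · have hF : ∫ ξ in (0 : ℝ)..x, g 1 ξ = g 0 x - g 0 0 :=
      intervalIntegral.integral_eq_sub_of_hasDerivAt_of_le hx.1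
        ((hc 0 (by norm_num)).mono (Set.Icc_subset_Icc_right hx.2))
        (fun ξ hξ => hd 0 (by norm_num) ξ ⟨hξ.1, hξ.2.trans_le hx.2⟩)
        (ContinuousOn.intervalIntegrable (by
          rw [Set.uIcc_of_le hx.1]
          exact (hc 1 (by norm_num)).mono (Set.Icc_subset_Icc_right hx.2)))
    have h := integral_sub_rpow_mul_eq_iterate (p := 0) (by norm_num) hx hc hd hy0
    simp only [Real.rpow_zero, one_mul, zero_add] at h
    rw [hF, hg0, show y 0 = 0 by simpa using hy0 0 (by norm_num), sub_zero,
      ← intervalIntegral.integral_const_mul] at h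
    rw [h]
    refine intervalIntegral.integral_congr fun t _ => ?_
    have : (x - t) ^ (3 : ℝ) = (x - t) ^ 3 := by norm_cast
    simp only [this]
    ring
  · have h := integral_sub_rpow_mul_eq_iterate (p := -α) (by linarith) hx hc hd hy0
    have e : ∫ ξ in (0 : ℝ)..x, deriv y ξ / (x - ξ) ^ α
        = ∫ ξ in (0 : ℝ)..x, (x - ξ) ^ (-α) * g 1 ξ := by
      refine intervalIntegral.integral_congr_ae ?_
      -- The endpoint is discarded: when x = T, `deriv y` need not agree there with the one-sided
      -- derivative.
      filter_upwards [MeasureTheory.Measure.ae_ne MeasureTheory.volume x] with ξ hξ hξ'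
      rw [Set.uIoc_of_le hx.1] at hξ'
      have hlt : ξ < x := lt_of_le_of_ne hξ'.2 hξ
      have := (hd 0 (by norm_num) ξ ⟨hξ'.1, hlt.trans_le hx.2⟩).deriv
      rw [hg0] at this
      rw [this, Real.rpow_neg (by linarith)]
      ring
    rw [caputoDeriv, e, h, Gamma_four_sub hα1, ← intervalIntegral.integral_const_mul,
      ← intervalIntegral.integral_const_mul]
    refine intervalIntegral.integral_congr fun t _ => ?_
    have hΓ : 0 < Real.Gamma (1 - α) := Real.Gamma_pos_of_pos (by linarith)
    have h1 : -α + 1 = 1 - α := by ring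
    have h2 : -α + 2 = 2 - α := by ring
    have h3 : -α + 3 = 3 - α := by ring
    simp only [h1, h2, h3]
    have n1 : 1 - α ≠ 0 := by linarith
    have n2 : 2 - α ≠ 0 := by linarith
    have n3 : 3 - α ≠ 0 := by linarith
    field_simp

/-- Truncated powers put the integrals for all nodes on one interval, so that they combine into a
single kernel. -/
theorem integral_eq_integral_max {φ g : ℝ → ℝ} (hφ : Continuous φ) (hφ0 : φ 0 = 0) {b x : ℝ}
    (hb : 0 ≤ b) (hbx : b ≤ x) (hg : ContinuousOn g (Set.Icc 0 x)) :
    ∫ t in (0 : ℝ)..b, φ (b - t) * g t = ∫ t in (0 : ℝ)..x, φ (max (b - t) 0) * g t := by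
  have hint : ContinuousOn (fun t => φ (max (b - t) 0) * g t) (Set.Icc 0 x) :=
    (by fun_prop : Continuous fun t => φ (max (b - t) 0)).continuousOn.mul hg
  rw [← intervalIntegral.integral_add_adjacent_intervals (b := b)
    ((hint.mono (Set.Icc_subset_Icc_right hbx)).intervalIntegrable_of_Icc hb)
    ((hint.mono (Set.Icc_subset_Icc_left hb)).intervalIntegrable_of_Icc hbx)]
  have h2 : ∫ t in b..x, φ (max (b - t) 0) * g t = 0 := by
    rw [intervalIntegral.integral_congr (g := fun _ => (0 : ℝ))]
    · simp
    · intro t ht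
      rw [Set.uIcc_of_le hbx] at ht
      beta_reduce
      rw [max_eq_right (by linarith [ht.1]), hφ0, zero_mul]
  rw [h2, add_zero]
  refine intervalIntegral.integral_congr fun t ht => ?_
  rw [Set.uIcc_of_le hb] at ht
  rw [max_eq_left (by linarith [ht.2])]

/-! ### The truncation error -/

theorem node_sub_mem_Icc {T h : ℝ} {N n k : ℕ} (hN : 1 ≤ N) (hT : 0 < T) (hh : h = T / N)
    (hn : n ≤ N) : (((n - k : ℕ) : ℝ) * h) ∈ Set.Icc 0 T := by
  have hN' : (0 : ℝ) < N := by exact_mod_cast hN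
  have h1 : ((n - k : ℕ) : ℝ) ≤ N := by exact_mod_cast (Nat.sub_le n k).trans hn
  rw [hh]
  refine ⟨by positivity, ?_⟩
  calc ((n - k : ℕ) : ℝ) * (T / N) ≤ N * (T / N) := by gcongr
    _ = T := by field_simp

theorem sum_three_caputoWeight (α : ℝ) (v : ℕ → ℝ) :
    ∑ j ∈ Finset.range 3, caputoWeight α j * v j
      = (1 - 17 * α / 24 + α ^ 2 / 8) * v 0 + (11 * α / 12 - α ^ 2 / 4) * v 1
        + (α ^ 2 / 8 - 5 * α / 24) * v 2 := by
  simp [Finset.sum_range_succ, caputoWeight]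

theorem one_le_schemeGamma {α h : ℝ} (hα1 : α < 1) (hh : 0 ≤ h) : 1 ≤ schemeGamma α h := by
  have h1 : 0 ≤ h ^ α := Real.rpow_nonneg hh α
  have h2 : 0 ≤ 1 - 17 * α / 24 + α ^ 2 / 8 := by nlinarith [sq_nonneg α]
  rw [schemeGamma]
  nlinarith [mul_nonneg h1 h2]

/-- Linear form of the scheme, applied both to the exact values and to the numerical solution. -/
theorem schemeGamma_mul_sub_schemeRHS {α h : ℝ} (hα1 : α < 1) (hh : 0 ≤ h) (f : ℝ → ℝ)
    (u : ℕ → ℝ) (n : ℕ) :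
    schemeGamma α h * (u n - schemeRHS α h f u n)
      = ∑ k ∈ Finset.range (n + 1), grunwaldWeight α k * u (n - k)
        - h ^ α * ∑ j ∈ Finset.range 3, caputoWeight α j *
          (f (((n - j : ℕ) : ℝ) * h) - u (n - j)) := by
  have hγ : schemeGamma α h ≠ 0 := (one_pos.trans_le (one_le_schemeGamma hα1 hh)).ne'
  rw [schemeRHS, mul_sub, mul_inv_cancel_left₀ hγ, sum_three_caputoWeight,
    Finset.range_eq_Ico, Finset.sum_eq_sum_Ico_succ_bot (Nat.succ_pos n), grunwaldWeight_zero,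
    schemeGamma]
  simp only [Nat.sub_zero, zero_add]
  rw [show Finset.Ico 1 (n + 1) = Finset.Icc 1 n from rfl]
  ring

theorem exists_truncationError_le {α T : ℝ} (hα0 : 0 < α) (hα1 : α < 1) (hT : 0 < T)
    {f y : ℝ → ℝ} (hy : ContDiffOn ℝ 5 y (Set.Icc 0 T))
    (hy0 : ∀ k ≤ 3, iteratedDerivWithin k y (Set.Icc 0 T) 0 = 0)
    (hsol : ∀ x ∈ Set.Icc 0 T, caputoDeriv α y x + y x = f x) :
    ∃ B : ℝ, 0 ≤ B ∧ ∀ N : ℕ, 1 ≤ N → ∀ h : ℝ, h = T / N → ∀ n : ℕ, 2 ≤ n → n ≤ N →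
      schemeGamma α h * |truncationError α h f y n| ≤ B * h ^ (3 + α) := by
  obtain ⟨g, hg, hyg, hDg⟩ := exists_integral_representation hα1 hT hy hy0
  obtain ⟨C, hC0, hC⟩ := exists_abs_peanoKernel_le hα0 hα1
  obtain ⟨M, hM⟩ := isCompact_Icc.exists_bound_of_continuousOn hg
  have hM0 : 0 ≤ M := (norm_nonneg _).trans (hM 0 ⟨le_rfl, hT.le⟩)
  have hΓ : 0 < Real.Gamma (4 - α) := Real.Gamma_pos_of_pos (by linarith)
  have h1α : 0 < 1 - α := by linarith
  refine ⟨C * M * (T ^ (1 - α) / (1 - α)), by positivity, fun N hN h hh n hn2 hnN => ?_⟩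
  have hN' : (0 : ℝ) < N := by exact_mod_cast hN
  have hh0 : 0 < h := by rw [hh]; positivity
  have hmem : ∀ k, (((n - k : ℕ) : ℝ) * h) ∈ Set.Icc 0 T := fun k =>
    node_sub_mem_Icc hN hT hh hnN
  set x : ℝ := (n : ℝ) * h with hx
  have hxT : x ∈ Set.Icc 0 T := by simpa using hmem 0
  have hgx : ContinuousOn g (Set.Icc 0 x) := hg.mono (Set.Icc_subset_Icc_right hxT.2)
  have hmax : ∀ k ≤ n, ∀ t, max (((n - k : ℕ) : ℝ) * h - t) 0 = h * max ((x - t) / h - k) 0 := by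
    intro k hk t
    rw [mul_max_of_nonneg _ _ hh0.le, mul_zero, Nat.cast_sub hk, hx]
    congr 1
    field_simp
    ring
  have hle : ∀ k, ((n - k : ℕ) : ℝ) * h ≤ x := fun k => by
    have : ((n - k : ℕ) : ℝ) ≤ n := by exact_mod_cast Nat.sub_le n k
    exact mul_le_mul_of_nonneg_right this hh0.le
  have hy' : ∀ k ≤ n, y (((n - k : ℕ) : ℝ) * h)
      = ∫ t in (0 : ℝ)..x, h ^ 3 * ((max ((x - t) / h - k) 0) ^ 3 / 6) * g t := by
    intro k hk
    rw [hyg _ (hmem k), integral_eq_integral_max (φ := fun s => s ^ 3 / 6) (by fun_prop) (by simp)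
      (hmem k).1 (hle k) hgx]
    refine intervalIntegral.integral_congr fun t _ => ?_
    simp only [hmax k hk]
    ring
  have hα3 : (0 : ℝ) < 3 - α := by linarith
  have hD' : ∀ k ≤ n, h ^ α * caputoDeriv α y (((n - k : ℕ) : ℝ) * h)
      = ∫ t in (0 : ℝ)..x, h ^ 3 * ((max ((x - t) / h - k) 0) ^ (3 - α) / Real.Gamma (4 - α))
          * g t := by
    intro k hk
    rw [hDg _ (hmem k), integral_eq_integral_max
      (φ := fun s => s ^ (3 - α) / Real.Gamma (4 - α))
      ((continuous_id.rpow_const fun _ => Or.inr hα3.le).div_const _)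
      (by simp [Real.zero_rpow hα3.ne']) (hmem k).1 (hle k) hgx,
      ← intervalIntegral.integral_const_mul]
    refine intervalIntegral.integral_congr fun t _ => ?_
    simp only [hmax k hk]
    rw [Real.mul_rpow hh0.le (le_max_right _ _)]
    -- The factor h^α gives the Caputo kernel the same scaling h^3 as the cubic one.
    have : h ^ α * h ^ (3 - α) = h ^ 3 := by
      rw [← Real.rpow_add hh0, add_sub_cancel]; norm_cast
    rw [← this]
    ring
  have hc1 : ∀ k : ℕ, IntervalIntegrable
      (fun t => h ^ 3 * ((max ((x - t) / h - k) 0) ^ 3 / 6) * g t) MeasureTheory.volume 0 x :=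
    fun k => ((by fun_prop : Continuous fun t : ℝ =>
      h ^ 3 * ((max ((x - t) / h - k) 0) ^ 3 / 6)).continuousOn.mul hgx).intervalIntegrable_of_Icc
        hxT.1
  have hc2 : ∀ k : ℕ, IntervalIntegrable (fun t => h ^ 3 *
      ((max ((x - t) / h - k) 0) ^ (3 - α) / Real.Gamma (4 - α)) * g t)
      MeasureTheory.volume 0 x := fun k => by
    have : Continuous fun t : ℝ => (max ((x - t) / h - k) 0) ^ (3 - α) :=
      (by fun_prop : Continuous fun t : ℝ => max ((x - t) / h - k) 0).rpow_const
        fun _ => Or.inr hα3.le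
    exact ((by fun_prop : Continuous fun t : ℝ => h ^ 3 *
      ((max ((x - t) / h - k) 0) ^ (3 - α) / Real.Gamma (4 - α))).continuousOn.mul
        hgx).intervalIntegrable_of_Icc hxT.1
  have hA : schemeGamma α h * truncationError α h f y n
      = ∫ t in (0 : ℝ)..x, h ^ 3 * peanoKernel α n ((x - t) / h) * g t := by
    rw [truncationError, schemeGamma_mul_sub_schemeRHS hα1 hh0.le f (fun m => y ((m : ℝ) * h)),
      Finset.mul_sum]
    have e1 : ∑ k ∈ Finset.range (n + 1), grunwaldWeight α k * y (((n - k : ℕ) : ℝ) * h)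
        = ∫ t in (0 : ℝ)..x, ∑ k ∈ Finset.range (n + 1), grunwaldWeight α k *
          (h ^ 3 * ((max ((x - t) / h - k) 0) ^ 3 / 6) * g t) := by
      rw [intervalIntegral.integral_finsetSum fun k _ => (hc1 k).const_mul _]
      refine Finset.sum_congr rfl fun k hk => ?_
      rw [hy' k (Nat.le_of_lt_succ (Finset.mem_range.1 hk)), intervalIntegral.integral_const_mul]
    have e2 : ∑ j ∈ Finset.range 3, h ^ α * (caputoWeight α j *
          (f (((n - j : ℕ) : ℝ) * h) - y (((n - j : ℕ) : ℝ) * h)))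
        = ∫ t in (0 : ℝ)..x, ∑ j ∈ Finset.range 3, caputoWeight α j *
          (h ^ 3 * ((max ((x - t) / h - j) 0) ^ (3 - α) / Real.Gamma (4 - α)) * g t) := by
      rw [intervalIntegral.integral_finsetSum fun k _ => (hc2 k).const_mul _]
      refine Finset.sum_congr rfl fun j hj => ?_
      rw [intervalIntegral.integral_const_mul, ← hD' j (by have := Finset.mem_range.1 hj; omega),
        ← hsol _ (hmem j)]
      ring
    rw [e1, e2, ← intervalIntegral.integral_sub]
    · refine intervalIntegral.integral_congr fun t _ => ?_
      simp only [peanoKernel]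
      rw [mul_sub, sub_mul, Finset.mul_sum, Finset.mul_sum, Finset.sum_mul, Finset.sum_mul]
      congr 1 <;> exact Finset.sum_congr rfl fun k _ => by ring
    · simpa only [Finset.sum_fn] using
        IntervalIntegrable.sum (Finset.range (n + 1)) fun k _ => (hc1 k).const_mul _
    · simpa only [Finset.sum_fn] using
        IntervalIntegrable.sum (Finset.range 3) fun k _ => (hc2 k).const_mul _
  have hpow : ∀ t, t < x → h ^ 3 * (C * ((x - t) / h) ^ (-α)) * M
      = C * M * h ^ (3 + α) * (x - t) ^ (-α) := by
    intro t ht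
    rw [Real.div_rpow (by linarith) hh0.le, Real.rpow_neg hh0.le, Real.rpow_add hh0, div_inv_eq_mul]
    norm_cast
    ring
  have hint : IntervalIntegrable (fun t => C * M * h ^ (3 + α) * (x - t) ^ (-α))
      MeasureTheory.volume 0 x := by
    have := (intervalIntegral.intervalIntegrable_rpow' (a := x) (b := 0) (r := -α)
      (by linarith)).comp_sub_left x
    simp only [sub_self, sub_zero] at this
    exact this.const_mul _
  have hB : |∫ t in (0 : ℝ)..x, h ^ 3 * peanoKernel α n ((x - t) / h) * g t|
      ≤ ∫ t in (0 : ℝ)..x, C * M * h ^ (3 + α) * (x - t) ^ (-α) := by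
    rw [← Real.norm_eq_abs]
    refine intervalIntegral.norm_integral_le_of_norm_le hxT.1 ?_ hint
    filter_upwards [MeasureTheory.Measure.ae_ne MeasureTheory.volume x] with t ht ht'
    have hlt : t < x := lt_of_le_of_ne ht'.2 ht
    rw [← hpow t hlt, norm_mul, norm_mul, Real.norm_eq_abs, Real.norm_eq_abs,
      abs_of_pos (by positivity : 0 < h ^ 3)]
    have h1 := hC n ((x - t) / h) (div_pos (by linarith) hh0)
      (by rw [div_le_iff₀ hh0]; linarith [ht'.1])
    have h2 := hM t ⟨ht'.1.le, ht'.2.trans hxT.2⟩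
    have h3 : 0 ≤ C * ((x - t) / h) ^ (-α) := (abs_nonneg _).trans h1
    exact mul_le_mul (mul_le_mul_of_nonneg_left h1 (by positivity)) h2 (norm_nonneg _)
      (by positivity)
  have hval : ∫ t in (0 : ℝ)..x, C * M * h ^ (3 + α) * (x - t) ^ (-α)
      = C * M * h ^ (3 + α) * (x ^ (1 - α) / (1 - α)) := by
    rw [intervalIntegral.integral_const_mul,
      intervalIntegral.integral_comp_sub_left (fun s => s ^ (-α)) x, sub_self, sub_zero,
      integral_rpow (Or.inl (by linarith)), Real.zero_rpow (by linarith), sub_zero,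
      show -α + 1 = 1 - α by ring]
  have hγ : 0 < schemeGamma α h := one_pos.trans_le (one_le_schemeGamma hα1 hh0.le)
  calc schemeGamma α h * |truncationError α h f y n|
      = |schemeGamma α h * truncationError α h f y n| := by rw [abs_mul, abs_of_pos hγ]
    _ ≤ C * M * h ^ (3 + α) * (x ^ (1 - α) / (1 - α)) := by rw [hA, ← hval]; exact hB
    _ ≤ C * M * h ^ (3 + α) * (T ^ (1 - α) / (1 - α)) := by
        have := hxT.1
        have := hxT.2
        gcongr
    _ = _ := by ring

/-! ### Stability and convergence -/

/-- Every partial sum is needed: for n = 2 the c_2 term multiplies e_0 = 0 and drops out, leaving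
c_1 alone. -/
theorem sum_caputoWeight_succ_nonneg {α : ℝ} (hα0 : 0 < α) (hα1 : α < 1) (m : ℕ) :
    0 ≤ ∑ k ∈ Finset.range (m + 1), caputoWeight α (k + 1) := by
  have h1 : 0 ≤ caputoWeight α 1 := by simp only [caputoWeight]; nlinarith
  have h2 : 0 ≤ caputoWeight α 1 + caputoWeight α 2 := by simp only [caputoWeight]; nlinarith
  rcases m with _ | m
  · simpa using h1
  · have : ∑ k ∈ Finset.range (m + 1 + 1), caputoWeight α (k + 1)
        = caputoWeight α 1 + caputoWeight α 2 := by
      induction m with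
      | zero => simp [Finset.sum_range_succ]
      | succ m ih => rw [Finset.sum_range_succ, ih, add_eq_left]; rfl
    rwa [this]

/-- Only c_1 is a positive perturbation, and c_1 ≤ 11α/12 < α = -w_1; this is where h^α ≤ 1 enters.
-/
theorem grunwaldWeight_add_mul_caputoWeight_nonpos {α : ℝ} (hα0 : 0 < α) (hα1 : α < 1) {s : ℝ}
    (hs0 : 0 ≤ s) (hs1 : s ≤ 1) (k : ℕ) :
    grunwaldWeight α (k + 1) + s * caputoWeight α (k + 1) ≤ 0 := by
  match k with
  | 0 =>
    have h := grunwaldWeight_succ α 0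
    simp only [Nat.cast_zero, zero_add, one_mul, zero_sub, grunwaldWeight_zero, mul_one] at h ⊢
    rw [h]
    simp only [caputoWeight]
    have h1 : 0 ≤ 11 * α / 12 - α ^ 2 / 4 := by nlinarith
    nlinarith [mul_le_of_le_one_left h1 hs1, sq_nonneg α]
  | 1 =>
    have h := grunwaldWeight_succ_nonpos hα0 hα1 1
    have h1 : caputoWeight α 2 ≤ 0 := by simp only [caputoWeight]; nlinarith
    linarith [mul_nonpos_of_nonneg_of_nonpos hs0 h1]
  | k + 2 =>
    have h := grunwaldWeight_succ_nonpos hα0 hα1 (k + 2)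
    have h1 : caputoWeight α (k + 2 + 1) = 0 := rfl
    rwa [h1, mul_zero, add_zero]

/-- Strong induction: past errors contribute at most (1 - P_(n-1)) B n^α, and the gap P_(n-1) B n^α
≥ (1-α) B covers δ. -/
theorem abs_le_mul_rpow_of_recurrence {α h δ B : ℝ} (hα0 : 0 < α) (hα1 : α < 1) (hh0 : 0 < h)
    (hh1 : h ≤ 1) (hB : 0 ≤ B) (hδB : δ ≤ (1 - α) * B) {e r : ℕ → ℝ} {N : ℕ} (he0 : e 0 = 0)
    (he1 : |e 1| ≤ B) (hr : ∀ n, 2 ≤ n → n ≤ N → |r n| ≤ δ)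
    (hrec : ∀ n, 2 ≤ n → n ≤ N → r n = ∑ k ∈ Finset.range (n + 1), grunwaldWeight α k * e (n - k)
      + h ^ α * ∑ j ∈ Finset.range 3, caputoWeight α j * e (n - j)) :
    ∀ n, n ≤ N → |e n| ≤ B * (n : ℝ) ^ α := by
  intro n
  induction n using Nat.strong_induction_on with
  | _ n ih =>
    intro hnN
    match n, ih, hnN with
    | 0, _, _ => simp [he0, hα0.ne']
    | 1, _, _ => simpa using he1
    | m + 2, ih, hnN =>
      have hs0 : 0 ≤ h ^ α := Real.rpow_nonneg hh0.le α
      have hs1 : h ^ α ≤ 1 := Real.rpow_le_one hh0.le hh1 hα0.le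
      have hc3 : ∑ j ∈ Finset.range 3, caputoWeight α j * e (m + 2 - j)
          = ∑ j ∈ Finset.range (m + 2 + 1), caputoWeight α j * e (m + 2 - j) := by
        refine Finset.sum_subset (Finset.range_mono (by omega)) fun j _ hj => ?_
        obtain ⟨i, rfl⟩ := Nat.exists_eq_add_of_le (not_lt.1 fun h => hj (Finset.mem_range.2 h))
        rw [add_comm, show caputoWeight α (i + 3) = 0 from rfl, zero_mul]
      have h1 := hrec (m + 2) (by omega) hnN
      rw [hc3, Finset.mul_sum, ← Finset.sum_add_distrib, Finset.sum_range_succ, Nat.sub_self, he0,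
        Finset.sum_range_succ', grunwaldWeight_zero, Nat.sub_zero] at h1
      have hγ : 1 ≤ 1 + h ^ α * caputoWeight α 0 := one_le_schemeGamma hα1 hh0.le
      -- Coefficients of the past errors once e_n is isolated; they are nonnegative.
      set a : ℕ → ℝ := fun k => -(grunwaldWeight α (k + 1) + h ^ α * caputoWeight α (k + 1)) with ha
      have ha0 : ∀ k, 0 ≤ a k := fun k => neg_nonneg.2
        (grunwaldWeight_add_mul_caputoWeight_nonpos hα0 hα1 hs0 hs1 k)
      have h2 : (1 + h ^ α * caputoWeight α 0) * e (m + 2)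
          = r (m + 2) + ∑ k ∈ Finset.range (m + 1), a k * e (m + 2 - (k + 1)) := by
        have : ∑ k ∈ Finset.range (m + 1), a k * e (m + 2 - (k + 1))
            = -∑ k ∈ Finset.range (m + 1), (grunwaldWeight α (k + 1) * e (m + 2 - (k + 1))
              + h ^ α * (caputoWeight α (k + 1) * e (m + 2 - (k + 1)))) := by
          rw [← Finset.sum_neg_distrib]
          exact Finset.sum_congr rfl fun k _ => by simp only [ha]; ring
        rw [this, h1]
        ring
      have hsum : ∑ k ∈ Finset.range (m + 1), a k ≤ 1 - grunwaldSum α (m + 1) := by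
        have e1 : grunwaldSum α (m + 1)
            = ∑ k ∈ Finset.range (m + 1), grunwaldWeight α (k + 1) + 1 := by
          rw [grunwaldSum, Finset.sum_range_succ', grunwaldWeight_zero]
        have e2 : ∑ k ∈ Finset.range (m + 1), a k
            = -∑ k ∈ Finset.range (m + 1), grunwaldWeight α (k + 1)
              - h ^ α * ∑ k ∈ Finset.range (m + 1), caputoWeight α (k + 1) := by
          rw [Finset.mul_sum, ← Finset.sum_neg_distrib, ← Finset.sum_sub_distrib]
          exact Finset.sum_congr rfl fun k _ => by simp only [ha]; ring
        have := mul_nonneg hs0 (sum_caputoWeight_succ_nonneg hα0 hα1 m)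
        linarith
      set z : ℝ := ((m + 2 : ℕ) : ℝ) ^ α with hz
      have hm2 : (0 : ℝ) < ((m + 2 : ℕ) : ℝ) := by positivity
      have hz0 : 0 < z := Real.rpow_pos_of_pos hm2 α
      have hP : 1 - α ≤ z * grunwaldSum α (m + 1) := by
        have h3 := one_sub_mul_rpow_le_grunwaldSum hα0 hα1 m
        have h4 : ((m + 2 : ℕ) : ℝ) ^ (-α) ≤ ((m : ℝ) + 1) ^ (-α) :=
          Real.rpow_le_rpow_of_nonpos (by positivity) (by push_cast; linarith) (by linarith)
        have h5 : z * ((m + 2 : ℕ) : ℝ) ^ (-α) = 1 := by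
          rw [hz, ← Real.rpow_add hm2]; simp
        calc 1 - α = z * ((1 - α) * ((m + 2 : ℕ) : ℝ) ^ (-α)) := by
              rw [mul_left_comm, h5, mul_one]
          _ ≤ z * grunwaldSum α (m + 1) := by
              refine mul_le_mul_of_nonneg_left (le_trans ?_ h3) hz0.le
              exact mul_le_mul_of_nonneg_left h4 (by linarith)
      have hbd : |∑ k ∈ Finset.range (m + 1), a k * e (m + 2 - (k + 1))|
          ≤ (1 - grunwaldSum α (m + 1)) * (B * z) := by
        refine (Finset.abs_sum_le_sum_abs _ _).trans ?_
        refine le_trans ?_ (mul_le_mul_of_nonneg_right hsum (by positivity))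
        rw [Finset.sum_mul]
        refine Finset.sum_le_sum fun k _ => ?_
        rw [abs_mul, abs_of_nonneg (ha0 k)]
        refine mul_le_mul_of_nonneg_left ?_ (ha0 k)
        refine (ih (m + 2 - (k + 1)) (by omega) (by omega)).trans ?_
        have : ((m + 2 - (k + 1) : ℕ) : ℝ) ≤ ((m + 2 : ℕ) : ℝ) := by exact_mod_cast Nat.sub_le _ _
        exact mul_le_mul_of_nonneg_left (Real.rpow_le_rpow (Nat.cast_nonneg _) this hα0.le) hB
      have hfin : (1 + h ^ α * caputoWeight α 0) * |e (m + 2)| ≤ B * z := by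
        rw [← abs_of_pos (one_pos.trans_le hγ), ← abs_mul, h2]
        refine (abs_add_le _ _).trans ?_
        have := hr (m + 2) (by omega) hnN
        nlinarith [mul_le_mul_of_nonneg_left hP hB]
      exact (le_mul_of_one_le_left (abs_nonneg _) hγ).trans hfin

/-! ### Convergence and the final constant -/

/-- Controls the starting error y(h), as the numerical value at node 1 is 0. -/
theorem exists_abs_le_mul_pow_four {α T : ℝ} (hα1 : α < 1) (hT : 0 < T)
    {y : ℝ → ℝ} (hy : ContDiffOn ℝ 5 y (Set.Icc 0 T))
    (hy0 : ∀ k ≤ 3, iteratedDerivWithin k y (Set.Icc 0 T) 0 = 0) :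
    ∃ M : ℝ, 0 ≤ M ∧ ∀ x ∈ Set.Icc 0 T, |y x| ≤ M * x ^ 4 := by
  obtain ⟨g, hg, hyg, -⟩ := exists_integral_representation hα1 hT hy hy0
  obtain ⟨M, hM⟩ := isCompact_Icc.exists_bound_of_continuousOn hg
  refine ⟨M, (norm_nonneg _).trans (hM 0 ⟨le_rfl, hT.le⟩), fun x hx => ?_⟩
  rw [hyg x hx, ← Real.norm_eq_abs]
  have := intervalIntegral.norm_integral_le_of_norm_le_const (a := 0) (b := x) (C := x ^ 3 * M)
    (f := fun t => (x - t) ^ 3 / 6 * g t) fun t ht => by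
      rw [Set.uIoc_of_le hx.1] at ht
      have h0 : 0 ≤ x - t := by linarith [ht.2]
      rw [norm_mul, Real.norm_of_nonneg (by positivity)]
      refine mul_le_mul ?_ (hM t ⟨ht.1.le, ht.2.trans hx.2⟩) (norm_nonneg _)
        (pow_nonneg hx.1 3)
      have : (x - t) ^ 3 ≤ x ^ 3 := pow_le_pow_left₀ h0 (by linarith [ht.1]) 3
      have : 0 ≤ (x - t) ^ 3 := by positivity
      linarith
  refine this.trans (le_of_eq ?_)
  rw [sub_zero, abs_of_nonneg hx.1]
  ring

/-- Convergence with an unspecified constant for all sufficiently fine grids. -/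
theorem exists_abs_error_le_of_step_le_one {α T : ℝ} (hα0 : 0 < α) (hα1 : α < 1) (hT : 0 < T)
    {f y : ℝ → ℝ} (hy : ContDiffOn ℝ 5 y (Set.Icc 0 T))
    (hy0 : ∀ k ≤ 3, iteratedDerivWithin k y (Set.Icc 0 T) 0 = 0)
    (hsol : ∀ x ∈ Set.Icc 0 T, caputoDeriv α y x + y x = f x) :
    ∃ B : ℝ, 0 ≤ B ∧ ∀ N : ℕ, 1 ≤ N → ∀ h : ℝ, h = T / N → h ≤ 1 → ∀ n : ℕ, n ≤ N →
      |y ((n : ℝ) * h) - numericalSolution α h f n| ≤ B * (n : ℝ) ^ α * h ^ (3 + α) := by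
  obtain ⟨B, hB0, hB⟩ := exists_truncationError_le hα0 hα1 hT hy hy0 hsol
  obtain ⟨M, hM0, hM⟩ := exists_abs_le_mul_pow_four hα1 hT hy hy0
  have h1α : 0 < 1 - α := by linarith
  -- The first summand absorbs the residual, the second the starting error M h^4 ≤ M h^(3+α).
  set D : ℝ := B / (1 - α) + M with hD
  have hD0 : 0 ≤ D := by positivity
  refine ⟨D, hD0, fun N hN h hh hh1 n hn => ?_⟩
  have hN' : (0 : ℝ) < N := by exact_mod_cast hN
  have hh0 : 0 < h := by rw [hh]; positivity
  have hq : 0 < h ^ (3 + α) := Real.rpow_pos_of_pos hh0 _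
  have hy00 : y 0 = 0 := by simpa using hy0 0 (by norm_num)
  have main := abs_le_mul_rpow_of_recurrence (δ := B * h ^ (3 + α)) (B := D * h ^ (3 + α))
    (e := fun n => y ((n : ℝ) * h) - numericalSolution α h f n)
    (r := fun n => schemeGamma α h * truncationError α h f y n) (N := N) hα0 hα1 hh0 hh1
    (by positivity) ?_ ?_ ?_ ?_ ?_ n hn
  · calc _ ≤ _ := main
      _ = _ := by ring
  · rw [← mul_assoc]
    refine mul_le_mul_of_nonneg_right ?_ hq.le
    rw [hD, mul_add, mul_div_cancel₀ _ h1α.ne']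
    have := mul_nonneg h1α.le hM0
    linarith
  · simp [numericalSolution_zero, hy00]
  · simp only [Nat.cast_one, one_mul, numericalSolution_one, sub_zero]
    have hhT : h ≤ T := by
      rw [hh]; exact div_le_self hT.le (by exact_mod_cast hN)
    refine (hM h ⟨hh0.le, hhT⟩).trans ?_
    have h4 : h ^ 4 ≤ h ^ (3 + α) := by
      rw [← Real.rpow_natCast]
      exact Real.rpow_le_rpow_of_exponent_ge hh0 hh1 (by push_cast; linarith)
    refine mul_le_mul ?_ h4 (by positivity) hD0
    have : 0 ≤ B / (1 - α) := by positivity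
    linarith
  · intro n hn2 hnN
    rw [abs_mul, abs_of_pos (one_pos.trans_le (one_le_schemeGamma hα1 hh0.le))]
    exact hB N hN h hh n hn2 hnN
  · intro n hn2 _
    have h1 := schemeGamma_mul_sub_schemeRHS hα1 hh0.le f (fun m => y ((m : ℝ) * h)) n
    have h2 := schemeGamma_mul_sub_schemeRHS hα1 hh0.le f (numericalSolution α h f) n
    rw [← numericalSolution_recurrence α h f hn2, sub_self, mul_zero] at h2
    rw [truncationError, h1, ← sub_zero (_ - _), h2]
    simp only [mul_sub, Finset.sum_sub_distrib]
    ring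

theorem theorem14 (α T : ℝ) (hα0 : 0 < α) (hα1 : α < 1) (hT : 0 < T) (f y : ℝ → ℝ)
    (hy : ContDiffOn ℝ 5 y (Set.Icc 0 T))
    (hy0 : ∀ k ≤ 3, iteratedDerivWithin k y (Set.Icc 0 T) 0 = 0)
    (hsol : ∀ x ∈ Set.Icc 0 T, caputoDeriv α y x + y x = f x) :
    ∃ A : ℝ, 0 < A ∧ ∀ N : ℕ, 1 ≤ N → ∀ h : ℝ, h = T / N →
      (∀ n : ℕ, 2 ≤ n → n ≤ N → |truncationError α h f y n| < A * h ^ (3 + α)) ∧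
      (∀ n : ℕ, 1 ≤ n → n ≤ N →
        |y ((n : ℝ) * h) - numericalSolution α h f n|
          < 10 * A / ((1 - α) * 2 ^ α) * (n : ℝ) ^ α * h ^ (3 + α)) ∧
      (∀ n : ℕ, n ≤ N →
        |y ((n : ℝ) * h) - numericalSolution α h f n|
          < 10 * A * T ^ α / ((1 - α) * 2 ^ α) * h ^ 3) := by
  obtain ⟨B₁, hB₁0, hB₁⟩ := exists_truncationError_le hα0 hα1 hT hy hy0 hsol
  obtain ⟨B₂, hB₂0, hB₂⟩ := exists_abs_error_le_of_step_le_one hα0 hα1 hT hy hy0 hsol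
  have h1α : 0 < 1 - α := by linarith
  have hy00 : y 0 = 0 := by simpa using hy0 0 (by norm_num)
  -- N ≥ N₀ forces h ≤ 1. The finitely many coarser grids are covered by `B₃`, the sum of their
  -- normalized errors; at n = 0 the quotient is 0, as 0^α = 0.
  obtain ⟨N₀, hN₀⟩ := exists_nat_ge T
  let F : ℕ → ℕ → ℝ := fun N n => |y ((n : ℝ) * (T / N)) - numericalSolution α (T / N) f n|
    / ((n : ℝ) ^ α * (T / N) ^ (3 + α))
  have hF0 : ∀ N n, 0 ≤ F N n := fun N n => by positivity
  set B₃ : ℝ := ∑ N ∈ Finset.range N₀, ∑ n ∈ Finset.range (N + 1), F N n with hB₃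
  have hB₃0 : 0 ≤ B₃ := Finset.sum_nonneg fun N _ => Finset.sum_nonneg fun n _ => hF0 N n
  set κ : ℝ := (1 - α) * 2 ^ α with hκ
  have hκ0 : 0 < κ := by positivity
  have hbound : ∀ N : ℕ, 1 ≤ N → ∀ h : ℝ, h = T / N → ∀ n : ℕ, 1 ≤ n → n ≤ N →
      |y ((n : ℝ) * h) - numericalSolution α h f n| ≤ (B₂ + B₃) * ((n : ℝ) ^ α * h ^ (3 + α)) := by
    intro N hN h hh n hn hnN
    have hN' : (0 : ℝ) < N := by exact_mod_cast hN
    have hh0 : 0 < h := by rw [hh]; positivity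
    have hn' : (0 : ℝ) < n := by exact_mod_cast hn
    have hpos : 0 < (n : ℝ) ^ α * h ^ (3 + α) := by positivity
    rcases lt_or_ge N N₀ with hlt | hge
    · have h1 : F N n ≤ B₃ :=
        (Finset.single_le_sum (f := fun n => F N n) (fun n _ => hF0 N n)
          (Finset.mem_range.2 (Nat.lt_succ_of_le hnN))).trans
        (Finset.single_le_sum (f := fun N => ∑ n ∈ Finset.range (N + 1), F N n)
          (fun N _ => Finset.sum_nonneg fun n _ => hF0 N n) (Finset.mem_range.2 hlt))
      simp only [F, ← hh] at h1
      rw [div_le_iff₀ hpos] at h1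
      refine h1.trans (mul_le_mul_of_nonneg_right (by linarith) hpos.le)
    · have hh1 : h ≤ 1 := by
        rw [hh, div_le_one hN']
        exact hN₀.trans (by exact_mod_cast hge)
      refine (hB₂ N hN h hh hh1 n hnN).trans ?_
      rw [mul_assoc]
      exact mul_le_mul_of_nonneg_right (by linarith) hpos.le
  -- Makes A > B₁ and 10A/κ > B₂ + B₃; the 1 gives strictness.
  set A : ℝ := B₁ + κ * (B₂ + B₃) / 10 + 1 with hA
  have hA0 : 0 < A := by positivity
  have hAκ : B₂ + B₃ < 10 * A / κ := by
    rw [lt_div_iff₀ hκ0, hA]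
    linarith
  refine ⟨A, hA0, fun N hN h hh => ?_⟩
  have hN' : (0 : ℝ) < N := by exact_mod_cast hN
  have hh0 : 0 < h := by rw [hh]; positivity
  have hq : 0 < h ^ (3 + α) := Real.rpow_pos_of_pos hh0 _
  have hb : ∀ n : ℕ, 1 ≤ n → n ≤ N → |y ((n : ℝ) * h) - numericalSolution α h f n|
      < 10 * A / κ * (n : ℝ) ^ α * h ^ (3 + α) := by
    intro n hn hnN
    have hn' : (0 : ℝ) < n := by exact_mod_cast hn
    rw [mul_assoc]
    exact (hbound N hN h hh n hn hnN).trans_lt (mul_lt_mul_of_pos_right hAκ (by positivity))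
  refine ⟨fun n hn2 hnN => ?_, hb, fun n hnN => ?_⟩
  · refine (le_mul_of_one_le_left (abs_nonneg _) (one_le_schemeGamma hα1 hh0.le)).trans_lt
      ((hB₁ N hN h hh n hn2 hnN).trans_lt (mul_lt_mul_of_pos_right ?_ hq))
    have : 0 ≤ κ * (B₂ + B₃) / 10 := by positivity
    linarith
  · rcases Nat.eq_zero_or_pos n with rfl | hn
    · simp only [Nat.cast_zero, zero_mul, hy00, numericalSolution_zero, sub_self, abs_zero]
      positivity
    · refine (hb n hn hnN).trans_le ?_
      have hn' : (0 : ℝ) < n := by exact_mod_cast hn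
      have hnh : (n : ℝ) * h ≤ T := (node_sub_mem_Icc (k := 0) hN hT hh hnN).2
      -- Trades n^α h^α for (nh)^α ≤ T^α.
      have e : (n : ℝ) ^ α * h ^ (3 + α) = ((n : ℝ) * h) ^ α * h ^ 3 := by
        rw [Real.mul_rpow hn'.le hh0.le, Real.rpow_add hh0]
        norm_cast
        ring
      rw [mul_assoc, e, mul_div_right_comm (10 * A) (T ^ α), mul_assoc _ (T ^ α)]
      gcongr
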